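/- A \emph{packing $c$-coloring} of a graph $H$ is a map $f$ from $V(H)$ onto $\{1,2,\ldots,c\}$ such that any two distinct vertices $u,v$ with $f(u)=f(v)=i$ satisfy $d_H(u,v)>i$, where $d_H$ is the usual shortest-path distance. The \emph{packing chromatic number} $\chi_\rho(H)$ is the smallest integer $c$ for which $H$ has a packing $c$-coloring. For a graph $G$ and a positive integer $n$, the \emph{generalized Sierpiński graph} $S_G^n$ of dimension $n$ has vertex set $V(G)^n$, and vertices $u=(u_1,\ldots,u_n)$ and $v=(v_1,\ldots,v_n)$ are adjacent if and only if there is $i\in\{1,\ldots,n\}$ such that $u_j=v_j$ for all $j<i$, $u_i\neq v_i$ and $u_iv_i\in E(G)$, and $u_j=v_i$ and $v_j=u_i$ for all $j>i$. The \emph{paw} is the graph on four vertices obtained from a triangle $K_3$ by joining one of its vertices to one further vertex. Write $S^n_{paw}$ for the generalized Sierpiński graph of the paw of dimension $n$. \textbf{Theorem.} $$\chi_\rho(S^n_{paw})=\begin{cases}3, & n=1,\\ 5, & n=2,\\ 7, & n=3,\\ 8, & n\ge 4.\end{cases}$$ -/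

import Mathlib

/-- The generalized Sierpiński graph of `G` of dimension `n`: its vertices are the words of
length `n` over the vertices of `G`, and `u`, `v` are adjacent iff for some position `i` they
agree before `i`, their letters at `i` are adjacent in `G`, and after `i` every letter of `u`
is `v i` and every letter of `v` is `u i`. -/
def genSierpinskiGraph {V : Type*} (G : SimpleGraph V) (n : ℕ) : SimpleGraph (Fin n → V) where
  Adj u v := ∃ i : Fin n, (∀ j, j < i → u j = v j) ∧ (u i ≠ v i ∧ G.Adj (u i) (v i)) ∧
    ∀ j, i < j → u j = v i ∧ v j = u i
  symm := ⟨fun _ _ ⟨i, h₁, h₂, h₃⟩ =>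
    ⟨i, fun j hj => (h₁ j hj).symm, ⟨h₂.1.symm, h₂.2.symm⟩, fun j hj => (h₃ j hj).symm⟩⟩
  loopless := ⟨fun _ ⟨_, _, h₂, _⟩ => h₂.1 rfl⟩

/-- `f` is a packing `c`-coloring of `G`: it maps the vertices onto the colors `1, …, c`, and any
two distinct vertices of the same color `i` are at distance greater than `i` (the distance being
infinite between different components). -/
def IsPackingColoring {V : Type*} (G : SimpleGraph V) (c : ℕ) (f : V → ℕ) : Prop :=
  Set.range f = Set.Icc 1 c ∧
    ∀ u v : V, u ≠ v → f u = f v → (f u : ℕ∞) < G.edist u v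

/-- The packing chromatic number: the smallest `c` for which `G` has a packing `c`-coloring
(`⊤` if there is none). -/
noncomputable def packingChromaticNumber {V : Type*} (G : SimpleGraph V) : ℕ∞ :=
  ⨅ c ∈ {c : ℕ | ∃ f : V → ℕ, IsPackingColoring G c f}, (c : ℕ∞)

/-- The paw: the triangle on `0, 1, 2` together with the vertex `3` joined to `2`. -/
def pawGraph : SimpleGraph (Fin 4) :=
  SimpleGraph.fromEdgeSet {s(0, 1), s(0, 2), s(1, 2), s(2, 3)}

/-! Lower bounds. A packing coloring restricts to any set of vertices, and a contradiction needs
only upper bounds on distances, which walks along listed edges provide. A search colors the vertices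
one by one and remembers only which pairs (later vertex, color) are already blocked. A state with
fewer blocked pairs admits every continuation of one with more, so states containing another kept
state may be dropped (`exists_mem_sweep`). For dimension at most 3, no state survives with one color
too few (`no_packing_of_states_eq_nil`).

From dimension 4 on, the copies of the three-dimensional graph with prefixes `0⋯0a`, for `a = 0, 1,
2`, are joined in a triangle. With 7 colors, three blocks of each copy are searched separately and
their states are joined at the linking corners. Every coloring then shows one of finitely many
patterns of occurrences of the colors 2, 5, 6 near the two corners facing the other copies
(`exists_pattern`). Among any three patterns, one for each copy, some two put equal colors `k`
within distance `k` across a linking edge (`ringCheck_patterns`), so 8 colors are needed.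

Upper bounds. Explicit tables settle dimension at most 3. In dimension `m + 3` the last three
letters are colored by a table selected by the last two different letters of the prefix. Distinct
corners of a block are more than 6 apart, so vertices within distance 8 lie in the same block or in
linked ones (`block_of_edist_le`). The tables of linked blocks form finitely many pairs
(`Linked.state`), all of which are checked.

The finite checks are run by the kernel; this dictates the recursors and the encoding of sets as
binary numbers. -/

noncomputable section

namespace Sweep

/-! ### Lists of numbers, evaluated by the kernel

A set of numbers is read off the binary digits of a number. The functions below are written
with recursors and the binary operations of `Nat` so that the kernel evaluates them quickly. -/

/-- `k x`, arranged so that kernel reduction evaluates the number `x` before `k`. -/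
def force {α : Type} (x : ℕ) (k : ℕ → α) : α :=
  Nat.rec (k (nat_lit 0)) (fun n _ => k n) (Nat.add x (nat_lit 1))

theorem force_eq {α : Type} (x : ℕ) (k : ℕ → α) : force x k = k x := rfl

/-- `x`; unfolding this constant keeps kernel reduction from nesting too deeply. -/
def delay {α : Type} (x : α) : α := x

/-- The continuation receives an explicit list of constructors, so that the list is not recomputed
at each use. -/
def forceList {α : Type} (l : List ℕ) : (List ℕ → α) → α :=
  List.rec (fun k => k []) (fun x _ ih k => delay (ih fun t => delay (k (x :: t)))) l

theorem forceList_eq {α : Type} (l : List ℕ) (k : List ℕ → α) : forceList l k = k l := by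
  induction l generalizing k with
  | nil => rfl
  | cons x l ih => exact ih _

def forcePairs {α : Type} (l : List (ℕ × ℕ)) : (List (ℕ × ℕ) → α) → α :=
  List.rec (fun k => k [])
    (fun p _ ih k => force p.1 fun a => force p.2 fun b => delay (ih fun t => delay (k ((a, b) :: t)))) l

theorem forcePairs_eq {α : Type} (l : List (ℕ × ℕ)) (k : List (ℕ × ℕ) → α) :
    forcePairs l k = k l := by
  induction l generalizing k with
  | nil => rfl
  | cons x l ih => exact ih _

/-- The numbers `(n ||| m) >>> c` for the `n` in `l` with `n &&& b = 0`. -/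
def expandOne (c b m : ℕ) (l : List ℕ) : List ℕ :=
  List.rec [] (fun n _ ih =>
    Nat.rec (motive := fun _ => ℕ → List ℕ → List ℕ)
      (fun n l => force (Nat.shiftRight (Nat.lor n m) c) fun a => a :: l)
      (fun _ _ _ l => delay l) (Nat.land n b) n ih) l

theorem expandOne_cons (c b m n : ℕ) (l : List ℕ) : expandOne c b m (n :: l) =
    if n &&& b = 0 then ((n ||| m) >>> c) :: expandOne c b m l else expandOne c b m l := by
  have key : expandOne c b m (n :: l) = Nat.rec (motive := fun _ => ℕ → List ℕ → List ℕ)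
      (fun n l => ((n ||| m) >>> c) :: l) (fun _ _ _ l => l) (n &&& b) n (expandOne c b m l) := rfl
  rw [key]
  cases h : n &&& b <;> simp

theorem mem_expandOne {c b m x : ℕ} {l : List ℕ} :
    x ∈ expandOne c b m l ↔ ∃ n ∈ l, n &&& b = 0 ∧ (n ||| m) >>> c = x := by
  induction l with
  | nil => simp [expandOne]
  | cons n l ih =>
    rw [expandOne_cons]
    split_ifs with h <;> simp [ih, h, eq_comm]

/-! ### Merging lists of states -/

/-- Merges two lists by comparing their heads. -/
def merge (l : List ℕ) : List ℕ → List ℕ :=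
  List.rec (fun r => r) (fun x xs ih r =>
    List.rec (motive := fun _ => ℕ → List ℕ → (List ℕ → List ℕ) → List ℕ) (fun x xs _ => x :: xs)
      (fun y ys ih' x xs ih =>
        Bool.rec (motive := fun _ => ℕ → List ℕ → (List ℕ → List ℕ) → ℕ → List ℕ →
            (ℕ → List ℕ → (List ℕ → List ℕ) → List ℕ) → List ℕ)
          (fun x xs ih y _ ih' => y :: ih' x xs ih) (fun x _ ih y ys _ => x :: ih (y :: ys))
          (Nat.ble x y) x xs ih y ys ih') r x xs ih) l

theorem merge_cons_cons (x y : ℕ) (xs ys : List ℕ) : merge (x :: xs) (y :: ys) =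
    if Nat.ble x y then x :: merge xs (y :: ys) else y :: merge (x :: xs) ys := by
  have key : merge (x :: xs) (y :: ys) = Bool.rec (motive := fun _ => List ℕ)
      (y :: merge (x :: xs) ys) (x :: merge xs (y :: ys)) (Nat.ble x y) := by
    change Bool.rec (motive := fun _ => ℕ → List ℕ → (List ℕ → List ℕ) → ℕ → List ℕ →
      (ℕ → List ℕ → (List ℕ → List ℕ) → List ℕ) → List ℕ) _ _ (Nat.ble x y) _ _ _ _ _ _ = _
    cases Nat.ble x y <;> rfl
  rw [key]
  cases Nat.ble x y <;> rfl

theorem mem_merge {z : ℕ} {l r : List ℕ} : z ∈ merge l r ↔ z ∈ l ∨ z ∈ r := by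
  induction l generalizing r with
  | nil => simp [merge]
  | cons x xs ih =>
    induction r with
    | nil => simp [merge]
    | cons y ys ih' =>
      rw [merge_cons_cons]
      split_ifs
      · simp [ih, or_assoc]
      · simp only [List.mem_cons, ih']; tauto

/-- One round of bottom-up merging; `o` holds at most one list waiting for a partner. Soundness uses
only membership. The order serves the pruning, since a subset is never the larger number. -/
def mergePairs (l : List (List ℕ)) : List (List ℕ) :=
  List.rec (fun o => o) (fun x _ ih (o : List (List ℕ)) =>
    List.rec (ih [x]) (fun y _ _ => merge y x :: ih []) o) l []

theorem mem_flatten_mergePairs {z : ℕ} {l : List (List ℕ)} :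
    z ∈ (mergePairs l).flatten ↔ z ∈ l.flatten := by
  let go : List (List ℕ) → List (List ℕ) → List (List ℕ) := fun l =>
    List.rec (fun o => o) (fun x _ ih (o : List (List ℕ)) =>
      List.rec (ih [x]) (fun y _ _ => merge y x :: ih []) o) l
  have key : ∀ l o : List (List ℕ), o.length ≤ 1 →
      (z ∈ (go l o).flatten ↔ z ∈ l.flatten ∨ z ∈ o.flatten) := by
    intro l
    induction l with
    | nil => intro o _; simp [go]
    | cons x l ih =>
      intro o ho
      match o, ho with
      | [], _ =>
        refine (ih [x] (by simp)).trans ?_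
        simp [or_comm]
      | [y], _ =>
        change z ∈ (merge y x :: go l []).flatten ↔ _
        rw [List.flatten_cons, List.mem_append, mem_merge, ih [] (by simp)]
        simp only [List.flatten_cons, List.flatten_nil, List.mem_append, List.not_mem_nil]
        tauto
  have := key l [] (by simp)
  simp only [List.flatten_nil, List.not_mem_nil, or_false] at this
  exact this

def mergeAll (l : List (List ℕ)) : List ℕ :=
  List.rec [] (fun x t ih => List.rec x (fun _ _ _ => merge x ih) t) l

theorem mem_mergeAll {z : ℕ} {l : List (List ℕ)} : z ∈ mergeAll l ↔ z ∈ l.flatten := by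
  induction l with
  | nil => simp [mergeAll]
  | cons x t ih =>
    cases t with
    | nil => simp [mergeAll]
    | cons y t =>
      change z ∈ merge x (mergeAll (y :: t)) ↔ _
      rw [mem_merge, ih, ← List.mem_append, ← List.flatten_cons]

/-! ### Inclusion of digit sets and pruning by lane arithmetic -/

/-- The digits of `x` are digits of `y`. -/
def Sub (x y : ℕ) : Prop := ∀ i, x.testBit i → y.testBit i

/-- `s`-bit lanes, the first one lowest. -/
def packed (s : ℕ) : List ℕ → ℕ
  | [] => 0
  | x :: l => x + 2 ^ s * packed s l

/-- Whether every lane of `W` meets `y`; `R`, `M`, `H` have in each lane the lowest bit, all bits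
but the highest, and the highest bit. -/
def allMeet (R M H W y : ℕ) : Bool :=
  Nat.beq (Nat.land (Nat.add (Nat.land (Nat.mul y R) W) M) H) H

theorem land_lanes {s a b u v : ℕ} (ha : a < 2 ^ s) (hb : b < 2 ^ s) :
    (a + 2 ^ s * u) &&& (b + 2 ^ s * v) = (a &&& b) + 2 ^ s * (u &&& v) := by
  apply Nat.eq_of_testBit_eq
  intro i
  have hab : a &&& b < 2 ^ s := lt_of_le_of_lt Nat.and_le_left ha
  rw [Nat.testBit_and, add_comm a, add_comm b, add_comm (a &&& b), Nat.testBit_two_pow_mul_add _ ha,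
    Nat.testBit_two_pow_mul_add _ hb, Nat.testBit_two_pow_mul_add _ hab]
  split_ifs <;> simp

theorem lane_eq_iff {s a b u v : ℕ} (ha : a < 2 ^ s) (hb : b < 2 ^ s) :
    a + 2 ^ s * u = b + 2 ^ s * v ↔ a = b ∧ u = v := by
  constructor
  · intro h
    have h1 := congrArg (· % 2 ^ s) h
    simp only [Nat.add_mul_mod_self_left, Nat.mod_eq_of_lt ha, Nat.mod_eq_of_lt hb] at h1
    subst h1
    have : 2 ^ s * u = 2 ^ s * v := by omega
    exact ⟨rfl, Nat.eq_of_mul_eq_mul_left (by positivity) this⟩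
  · rintro ⟨rfl, rfl⟩; rfl

/-- Adding `2 ^ w - 1` carries into bit `w` exactly when the lane is nonzero. The spare top bit of
each lane absorbs the carry, so all lanes can be tested by one addition. -/
theorem land_top_eq_iff {w t : ℕ} (ht : t < 2 ^ w) :
    (t + (2 ^ w - 1)) &&& 2 ^ w = 2 ^ w ↔ t ≠ 0 := by
  have hp : 0 < 2 ^ w := by positivity
  rcases Nat.eq_zero_or_pos t with rfl | h0
  · simp only [zero_add, ne_eq, not_true_eq_false, iff_false]
    rw [Nat.and_two_pow, Nat.testBit_lt_two_pow (by omega)]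
    simp; omega
  · have : t + (2 ^ w - 1) = 2 ^ w * 1 + (t - 1) := by omega
    rw [Nat.and_two_pow, this, Nat.testBit_two_pow_mul_add _ (by omega)]
    simp; omega

theorem allMeet_packed {w y : ℕ} (hy : y < 2 ^ w) (l : List ℕ) (hl : ∀ x ∈ l, x < 2 ^ w) :
    allMeet (packed (w + 1) (l.map fun _ => 1)) (packed (w + 1) (l.map fun _ => 1) * (2 ^ w - 1))
      (packed (w + 1) (l.map fun _ => 1) * 2 ^ w) (packed (w + 1) l) y = true ↔
      ∀ x ∈ l, y &&& x ≠ 0 := by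
  have key : ∀ R M H W : ℕ, allMeet R M H W y = true ↔ (((y * R) &&& W) + M) &&& H = H :=
    fun R M H W => Iff.of_eq Nat.beq_eq
  rw [key]
  induction l with
  | nil => simp [packed]
  | cons x l ih =>
    have hx := hl x (by simp)
    have hw : 2 ^ w + 2 ^ w = 2 ^ (w + 1) := by rw [pow_succ]; ring
    have hyx : y &&& x < 2 ^ w := lt_of_le_of_lt Nat.and_le_left hy
    have hp : 0 < 2 ^ w := by positivity
    replace ih := ih (fun x hx => hl x (List.mem_cons_of_mem _ hx))
    simp only [List.map_cons, packed]
    set R := packed (w + 1) (l.map fun _ => 1)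
    rw [show y * (1 + 2 ^ (w + 1) * R) = y + 2 ^ (w + 1) * (y * R) by ring,
      land_lanes (by omega) (by omega),
      show (y &&& x) + 2 ^ (w + 1) * ((y * R) &&& packed (w + 1) l) +
        (1 + 2 ^ (w + 1) * R) * (2 ^ w - 1) = ((y &&& x) + (2 ^ w - 1)) +
        2 ^ (w + 1) * (((y * R) &&& packed (w + 1) l) + R * (2 ^ w - 1)) by ring,
      show (1 + 2 ^ (w + 1) * R) * 2 ^ w = 2 ^ w + 2 ^ (w + 1) * (R * 2 ^ w) by ring,
      land_lanes (by omega) (by omega), lane_eq_iff (lt_of_le_of_lt Nat.and_le_right (by omega)) (by omega),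
      land_top_eq_iff hyx, List.forall_mem_cons]
    exact and_congr_right fun _ => ih

/-- The elements of `l` that contain none of the last elements kept; the latter are in the
lanes of `W`. -/
def window (F s R M H T : ℕ) (l : List ℕ) : ℕ → List ℕ :=
  List.rec (fun _ => []) (fun x _ ih W =>
    Bool.rec (motive := fun _ => ℕ → (ℕ → List ℕ) → ℕ → List ℕ) (fun _ ih W => delay (ih W))
      (fun x ih W => x :: force (Nat.mod (Nat.add (Nat.shiftLeft W s) x) T) ih)
      (allMeet R M H W (Nat.sub F x)) x ih W) l

theorem window_cons (F s R M H T x : ℕ) (l : List ℕ) (W : ℕ) : window F s R M H T (x :: l) W =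
    if allMeet R M H W (F - x) then x :: window F s R M H T l (((W <<< s) + x) % T)
    else window F s R M H T l W := by
  change Bool.rec (motive := fun _ => ℕ → (ℕ → List ℕ) → ℕ → List ℕ) _ _
    (allMeet R M H W (F - x)) _ _ _ = _
  cases allMeet R M H W (F - x) <;> rfl

theorem packed_lt {s : ℕ} (l : List ℕ) (hl : ∀ x ∈ l, x < 2 ^ s) : packed s l < 2 ^ (s * l.length) := by
  induction l with
  | nil => simp [packed]
  | cons x l ih =>
    have h1 := ih fun x hx => hl x (by simp [hx])
    have h2 := hl x (by simp)
    rw [packed, List.length_cons, mul_add, pow_add, mul_one, mul_comm _ (2 ^ s)]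
    calc x + 2 ^ s * packed s l < 2 ^ s * (packed s l + 1) := by rw [mul_add]; omega
      _ ≤ _ := Nat.mul_le_mul_left _ h1

/-- The window is a queue: a new element enters at the lowest lane and the reduction drops the
highest. -/
theorem packed_mod {s x : ℕ} (hx : x < 2 ^ s) (l : List ℕ) (hl : ∀ x ∈ l, x < 2 ^ s) :
    (packed s l * 2 ^ s + x) % 2 ^ (s * l.length) = packed s ((x :: l).take l.length) := by
  induction l generalizing x with
  | nil => simp [packed, Nat.mod_one]
  | cons y l ih =>
    have hy := hl y (by simp)
    have h1 := ih hy fun x hx => hl x (by simp [hx])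
    have h2 := packed_lt (List.take l.length (y :: l))
      (fun z hz => hl z (List.mem_of_mem_take hz))
    rw [List.length_cons, List.take_succ_cons, packed, packed, ← h1, mul_add s, mul_one,
      pow_add, mul_comm (2 ^ (s * l.length)) (2 ^ s),
      show (y + 2 ^ s * packed s l) * 2 ^ s + x = x + 2 ^ s * (packed s l * 2 ^ s + y) by ring]
    have hx' : x / 2 ^ s = 0 := Nat.div_eq_of_lt hx
    rw [Nat.mod_mul, Nat.add_mul_mod_self_left, Nat.mod_eq_of_lt hx,
      Nat.add_mul_div_left _ _ (by positivity), hx', zero_add]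

theorem sub_of_land_compl {w x y : ℕ} (hx : x < 2 ^ w) (hy : y < 2 ^ w)
    (h : (2 ^ w - 1 - x) &&& y = 0) : Sub y x := by
  intro i hi
  by_contra hxi
  have hiw : i < w := by
    by_contra hn
    rw [Nat.testBit_lt_two_pow (lt_of_lt_of_le hy (Nat.pow_le_pow_right (by norm_num) (not_lt.1 hn)))] at hi
    simp at hi
  have := congrArg (fun n => n.testBit i) h
  rw [show 2 ^ w - 1 - x = 2 ^ w - (x + 1) by omega] at this
  simp [Nat.testBit_two_pow_sub_succ hx, hi, hiw] at this
  simp [this] at hxi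

/-- An element is dropped only when its complement misses some lane, that is, when it contains an
element of the current window. Such an element was either kept earlier or there from the start. -/
theorem exists_mem_window {w x : ℕ} (l ys : List ℕ) (hl : ∀ x ∈ l, x < 2 ^ w)
    (hys : ∀ y ∈ ys, y < 2 ^ w) (hx : x ∈ l) :
    ∃ y ∈ window (2 ^ w - 1) (w + 1) (packed (w + 1) (ys.map fun _ => 1))
      (packed (w + 1) (ys.map fun _ => 1) * (2 ^ w - 1)) (packed (w + 1) (ys.map fun _ => 1) * 2 ^ w)
      (2 ^ ((w + 1) * ys.length)) l (packed (w + 1) ys) ++ ys, Sub y x := by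
  induction l generalizing ys with
  | nil => simp at hx
  | cons z l ih =>
    have hz := hl z (by simp)
    have hl' : ∀ x ∈ l, x < 2 ^ w := fun x hx => hl x (by simp [hx])
    have hw : 2 ^ w + 2 ^ w = 2 ^ (w + 1) := by rw [pow_succ]; ring
    rw [window_cons]
    have hm := allMeet_packed (w := w) (y := 2 ^ w - 1 - z) (by omega) ys hys
    split_ifs with h
    · rcases List.mem_cons.1 hx with rfl | hx
      · exact ⟨x, by simp, fun i hi => hi⟩
      · rw [Nat.shiftLeft_eq, packed_mod (by omega) ys fun y hy => by have := hys y hy; omega]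
        set zs := (z :: ys).take ys.length with hzs
        have hlen : zs.length = ys.length := by simp [hzs]
        have hmap : (ys.map fun _ => 1) = zs.map fun _ => (1 : ℕ) := by
          simp only [List.map_const', hlen]
        rw [hmap, ← hlen]
        have hmem : ∀ y ∈ zs, y = z ∨ y ∈ ys := fun y hy =>
          List.mem_cons.1 (List.mem_of_mem_take hy)
        obtain ⟨y, hy, hyx⟩ := ih zs hl' (fun y hy => (hmem y hy).elim (fun h => h ▸ hz) (hys y)) hx
        refine ⟨y, ?_, hyx⟩
        rcases List.mem_append.1 hy with hy | hy
        · exact List.mem_append_left _ (List.mem_cons_of_mem _ hy)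
        · rcases hmem y hy with rfl | hy
          · simp
          · exact List.mem_append_right _ hy
    · rcases List.mem_cons.1 hx with rfl | hx
      · rw [Bool.not_eq_true, ← Bool.not_eq_true, hm] at h
        push Not at h
        obtain ⟨y, hy, h0⟩ := h
        exact ⟨y, by simp [hy], sub_of_land_compl hz (hys y hy) h0⟩
      · exact ih ys hl' hys hx

theorem window_subset {F s R M H T : ℕ} {l : List ℕ} {W x : ℕ} (h : x ∈ window F s R M H T l W) :
    x ∈ l := by
  induction l generalizing W with
  | nil => simp [window] at h
  | cons z l ih =>
    rw [window_cons] at h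
    split_ifs at h
    · rcases List.mem_cons.1 h with rfl | h
      · simp
      · exact List.mem_cons_of_mem _ (ih h)
    · exact List.mem_cons_of_mem _ (ih h)

def lanes (B K : ℕ) : ℕ := Nat.rec (nat_lit 0) (fun _ n => Nat.add (Nat.mul n B) (nat_lit 1)) K

theorem lanes_eq (s K : ℕ) (l : List ℕ) (hl : l.length = K) :
    lanes (2 ^ s) K = packed s (l.map fun _ => 1) := by
  induction K generalizing l with
  | zero => simp [List.length_eq_zero_iff.1 hl, lanes, packed]
  | succ K ih =>
    obtain ⟨x, t, rfl⟩ := List.exists_cons_of_length_eq_add_one hl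
    have h : lanes (2 ^ s) (K + 1) = lanes (2 ^ s) K * 2 ^ s + 1 := rfl
    rw [List.map_cons, packed, ← ih t (by simpa using hl), h]
    ring

/-- Removes elements of `l` that contain one of the last `K` elements kept before them. -/
def prune (w K : ℕ) (l : List ℕ) : List ℕ :=
  force (Nat.sub (Nat.shiftLeft 1 w) 1) fun F => force (Nat.add w 1) fun s =>
  force (lanes (Nat.shiftLeft 1 s) K) fun R => force (Nat.mul R F) fun M =>
  force (Nat.mul R (Nat.shiftLeft 1 w)) fun H =>
  force (Nat.shiftLeft 1 (Nat.mul s K)) fun T => window F s R M H T l M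

theorem packed_replicate (s a K : ℕ) :
    packed s (List.replicate K a) = packed s ((List.replicate K a).map fun _ => 1) * a := by
  induction K with
  | zero => simp [packed]
  | succ K ih => rw [List.replicate_succ, List.map_cons, packed, packed, ih]; ring

theorem prune_eq (w K : ℕ) (l : List ℕ) : prune w K l =
    window (2 ^ w - 1) (w + 1) (lanes (2 ^ (w + 1)) K) (lanes (2 ^ (w + 1)) K * (2 ^ w - 1))
      (lanes (2 ^ (w + 1)) K * 2 ^ w) (2 ^ ((w + 1) * K)) l
      (lanes (2 ^ (w + 1)) K * (2 ^ w - 1)) := by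
  have h : ∀ n, Nat.shiftLeft 1 n = 2 ^ n := Nat.one_shiftLeft
  unfold prune
  simp only [force_eq, h]
  rfl

theorem prune_subset {w K x : ℕ} {l : List ℕ} (h : x ∈ prune w K l) : x ∈ l := by
  rw [prune_eq] at h
  exact window_subset h

/-- The window starts filled with all-ones lanes, which are contained only in the all-ones number;
`htop` excludes that case. -/
theorem exists_mem_prune {w K x : ℕ} (l : List ℕ) (hl : ∀ x ∈ l, x < 2 ^ w) (hx : x ∈ l)
    (htop : x ≠ 2 ^ w - 1) : ∃ y ∈ prune w K l, Sub y x := by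
  obtain ⟨y, hy, hyx⟩ := exists_mem_window l (List.replicate K (2 ^ w - 1)) hl
    (fun y hy => by rw [(List.mem_replicate.1 hy).2]; have : 0 < 2 ^ w := by positivity
                    omega) hx
  have hlen : (List.replicate K (2 ^ w - 1)).length = K := by simp
  rw [packed_replicate, ← lanes_eq (w + 1) K _ hlen, hlen, ← prune_eq] at hy
  rcases List.mem_append.1 hy with hy | hy
  · exact ⟨y, hy, hyx⟩
  · rw [(List.mem_replicate.1 hy).2] at hyx
    refine absurd (Nat.eq_of_testBit_eq fun i => ?_) htop
    have h1 := hyx i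
    rw [Nat.testBit_two_pow_sub_one] at h1 ⊢
    by_cases hi : i < w
    · simp [h1 (by simpa using hi), hi]
    · rw [Nat.testBit_lt_two_pow (lt_of_lt_of_le (hl x hx)
        (Nat.pow_le_pow_right (by norm_num) (not_lt.1 hi)))]
      simp [hi]

/-! ### Sweeping over the vertices -/

/-- The digit `j` of the result says whether the `j`-th slot has color `k` and contains `v`. -/
def touched (v k : ℕ) (slots : List (ℕ × ℕ)) : ℕ :=
  List.rec (motive := fun _ => ℕ → ℕ → ℕ) (fun _ a => a) (fun p _ ih i a =>
    force (Nat.lor a (Nat.shiftLeft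
      (Bool.rec (nat_lit 0) (Nat.land (Nat.shiftRight p.2 v) (nat_lit 1)) (Nat.beq p.1 k)) i)) fun a =>
    force (Nat.add i (nat_lit 1)) fun i => ih i a) slots (nat_lit 0) (nat_lit 0)

theorem testBit_touched {v k j : ℕ} {slots : List (ℕ × ℕ)} (h : (touched v k slots).testBit j) :
    ∃ p, slots[j]? = some p ∧ p.1 = k ∧ p.2.testBit v := by
  let go : List (ℕ × ℕ) → ℕ → ℕ → ℕ := fun l => List.rec (motive := fun _ => ℕ → ℕ → ℕ)
    (fun _ a => a) (fun p _ ih i a => force (Nat.lor a (Nat.shiftLeft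
      (Bool.rec (nat_lit 0) (Nat.land (Nat.shiftRight p.2 v) (nat_lit 1)) (Nat.beq p.1 k)) i)) fun a =>
    force (Nat.add i (nat_lit 1)) fun i => ih i a) l
  have key : ∀ (l : List (ℕ × ℕ)) (i a j : ℕ), (go l i a).testBit j → a.testBit j ∨
      ∃ t p, j = i + t ∧ l[t]? = some p ∧ p.1 = k ∧ p.2.testBit v := by
    intro l
    induction l with
    | nil => intro i a j h; exact Or.inl h
    | cons p l ih =>
      intro i a j h
      rcases ih (i + 1) _ j h with h | ⟨t, q, rfl, h1, h2⟩
      · change (a ||| ((Bool.rec 0 ((p.2 >>> v) &&& 1) (Nat.beq p.1 k) : ℕ) <<< i)).testBit j at h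
        rw [Nat.testBit_or, Bool.or_eq_true] at h
        refine h.imp_right fun h => ?_
        cases hb : Nat.beq p.1 k with
        | false => rw [hb] at h; simp at h
        | true =>
          rw [hb] at h
          simp only [Nat.testBit_shiftLeft, Nat.testBit_and, Nat.testBit_shiftRight,
            Bool.and_eq_true, decide_eq_true_eq] at h
          obtain ⟨hij, h1, h2⟩ := h
          have h0 : j - i = 0 := by
            by_contra hne
            rw [show (1 : ℕ) = 2 ^ 0 from rfl, Nat.testBit_two_pow_of_ne (by omega)] at h2
            simp at h2
          exact ⟨0, p, by omega, rfl, Nat.eq_of_beq_eq_true hb, by simpa [h0] using h1⟩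
      · exact Or.inr ⟨t + 1, q, by omega, by simpa using h1, h2⟩
  rcases key slots 0 0 j h with h | ⟨t, p, rfl, h'⟩
  · simp at h
  · rw [zero_add]; exact ⟨p, h'⟩

theorem touched_lt (v k : ℕ) (slots : List (ℕ × ℕ)) : touched v k slots < 2 ^ slots.length := by
  refine Nat.lt_pow_two_of_testBit _ fun i hi => ?_
  by_contra h
  obtain ⟨p, hp, -⟩ := testBit_touched (by simpa using h)
  rw [List.getElem?_eq_none hi] at hp
  simp at hp

/-- For each color `k ≤ C`, its digit and the slots touched when `v` gets color `k`. -/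
def options (C v : ℕ) (slots : List (ℕ × ℕ)) : List (ℕ × ℕ) :=
  Nat.rec (motive := fun _ => ℕ → List (ℕ × ℕ)) (fun _ => []) (fun _ ih i =>
    (Nat.shiftLeft (nat_lit 1) i, touched v (Nat.add i (nat_lit 1)) slots) ::
      ih (Nat.add i (nat_lit 1))) C (nat_lit 0)

theorem mem_options {C v : ℕ} {slots : List (ℕ × ℕ)} {p : ℕ × ℕ} :
    p ∈ options C v slots ↔ ∃ i < C, p = (2 ^ i, touched v (i + 1) slots) := by
  let go : ℕ → ℕ → List (ℕ × ℕ) := fun n => Nat.rec (motive := fun _ => ℕ → List (ℕ × ℕ))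
    (fun _ => []) (fun _ ih i => (Nat.shiftLeft (nat_lit 1) i, touched v (Nat.add i (nat_lit 1)) slots) ::
      ih (Nat.add i (nat_lit 1))) n
  have key : ∀ n i, p ∈ go n i ↔ ∃ t < n, p = (2 ^ (i + t), touched v (i + t + 1) slots) := by
    intro n
    induction n with
    | zero => intro i; simp [go]
    | succ n ih =>
      intro i
      change p ∈ (Nat.shiftLeft 1 i, touched v (i + 1) slots) :: go n (i + 1) ↔ _
      have h1 : Nat.shiftLeft 1 i = 2 ^ i := Nat.one_shiftLeft i
      rw [List.mem_cons, ih, h1]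
      constructor
      · rintro (rfl | ⟨t, ht, rfl⟩)
        · exact ⟨0, by omega, rfl⟩
        · exact ⟨t + 1, by omega, by ring_nf⟩
      · rintro ⟨t, ht, rfl⟩
        cases t with
        | zero => exact Or.inl rfl
        | succ t => exact Or.inr ⟨t, by omega, by ring_nf⟩
  have := key C 0
  simp only [zero_add] at this
  exact this

def expandAll (C : ℕ) (l : List ℕ) (o : List (ℕ × ℕ)) : List (List ℕ) :=
  List.rec [] (fun p _ ih => expandOne C p.1 p.2 l :: ih) o

theorem mem_flatten_expandAll {C x : ℕ} {l : List ℕ} {o : List (ℕ × ℕ)} :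
    x ∈ (expandAll C l o).flatten ↔ ∃ p ∈ o, x ∈ expandOne C p.1 p.2 l := by
  induction o with
  | nil => simp [expandAll]
  | cons p o ih =>
    change x ∈ (expandOne C p.1 p.2 l :: expandAll C l o).flatten ↔ _
    rw [List.flatten_cons, List.mem_append, ih]
    simp

def expand (C : ℕ) (o : List (ℕ × ℕ)) (l : List ℕ) : List ℕ :=
  mergeAll (mergePairs (mergePairs (expandAll C l o)))

theorem mem_expand {C x : ℕ} {o : List (ℕ × ℕ)} {l : List ℕ} :
    x ∈ expand C o l ↔ ∃ p ∈ o, ∃ n ∈ l, n &&& p.1 = 0 ∧ (n ||| p.2) >>> C = x := by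
  rw [expand, mem_mergeAll, mem_flatten_mergePairs, mem_flatten_mergePairs, mem_flatten_expandAll]
  simp only [mem_expandOne]

def dropFirst {α : Type} (n : ℕ) : List α → List α :=
  Nat.rec (fun s => s) (fun _ ih s => List.rec [] (fun _ t _ => ih t) s) n

theorem dropFirst_eq {α : Type} (n : ℕ) (l : List α) : dropFirst n l = l.drop n := by
  induction n generalizing l with
  | zero => rfl
  | succ n ih =>
    cases l with
    | nil => rfl
    | cons x l => exact ih l

/-- The states after coloring the vertices `vs` one by one, starting from the states `l`. A state
has a digit for every slot; the first `C` slots belong to the next vertex. -/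
def sweep (C K K' : ℕ) (vs : List ℕ) : List (ℕ × ℕ) → ℕ → List ℕ → List ℕ :=
  List.rec (fun _ _ l => l) (fun v t ih slots w l =>
    forcePairs (options C v slots) fun o => force (Nat.sub w C) fun w =>
    forceList (prune w (List.rec K' (fun _ _ _ => K) t) (expand C o l)) fun l =>
    ih (dropFirst C slots) w l) vs

theorem sweep_cons (C K K' v w : ℕ) (t : List ℕ) (slots : List (ℕ × ℕ)) (l : List ℕ) :
    sweep C K K' (v :: t) slots w l = sweep C K K' t (slots.drop C) (w - C)
      (prune (w - C) (List.rec K' (fun _ _ _ => K) t) (expand C (options C v slots) l)) := by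
  change forcePairs (options C v slots) (fun o => force (Nat.sub w C) fun w =>
    forceList (prune w (List.rec K' (fun _ _ _ => K) t) (expand C o l)) fun l =>
    sweep C K K' t (dropFirst C slots) w l) = _
  rw [forcePairs_eq, force_eq, forceList_eq, dropFirst_eq]
  rfl

/-- Some vertex in the slot `p` has the color of the slot. -/
def Hit (f : ℕ → ℕ) (U : List ℕ) (p : ℕ × ℕ) : Prop := ∃ v ∈ U, p.2.testBit v ∧ f v = p.1

/-- All slots recorded in the state `n` are hit. -/
def Good (f : ℕ → ℕ) (U : List ℕ) (slots : List (ℕ × ℕ)) (n : ℕ) : Prop :=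
  ∀ j, n.testBit j → ∃ p, slots[j]? = some p ∧ Hit f U p

/-- The first `C` slots for each of the vertices `vs` allow the coloring `f`. -/
def Fits (f : ℕ → ℕ) (U : List ℕ) (C : ℕ) : List ℕ → List (ℕ × ℕ) → Prop
  | [], _ => True
  | v :: t, slots => v ∈ U ∧ (1 ≤ f v ∧ f v ≤ C) ∧ C ≤ slots.length ∧
      (∀ p, slots[f v - 1]? = some p → ¬ Hit f U p) ∧ Fits f U C t (slots.drop C)

/-- `Good` passes to subsets, so when pruning replaces the state of `f` by a smaller one, that one
is again good for `f`, even if it arose from another coloring. A good state never forbids the color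
`f v`, since a set digit would give a genuine hit, excluded by `Fits`. -/
theorem exists_mem_sweep {f : ℕ → ℕ} {U : List ℕ} {C K K' : ℕ} (vs : List ℕ)
    (slots : List (ℕ × ℕ)) (l : List ℕ) (hf : Fits f U C vs slots)
    (hl : ∀ x ∈ l, x < 2 ^ (slots.length + 1)) (hgood : ∃ n ∈ l, Good f U slots n) :
    ∃ n ∈ sweep C K K' vs slots (slots.length + 1) l, Good f U (slots.drop (C * vs.length)) n := by
  induction vs generalizing slots l with
  | nil => simpa [sweep] using hgood
  | cons v t ih =>
    obtain ⟨hv, ⟨hf1, hfC⟩, hlen, hnot, hfit⟩ := hf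
    obtain ⟨n, hn, hng⟩ := hgood
    have hw : slots.length + 1 - C = (slots.drop C).length + 1 := by
      rw [List.length_drop]; omega
    have hbound : ∀ x ∈ expand C (options C v slots) l, x < 2 ^ ((slots.drop C).length + 1) := by
      intro x hx
      obtain ⟨p, hp, m, hm, -, rfl⟩ := mem_expand.1 hx
      obtain ⟨i, -, rfl⟩ := mem_options.1 hp
      rw [← hw, Nat.shiftRight_eq_div_pow, Nat.div_lt_iff_lt_mul (by positivity), ← pow_add,
        Nat.sub_add_cancel (by omega)]
      exact Nat.or_lt_two_pow (hl m hm) (lt_trans (touched_lt _ _ _)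
        (Nat.pow_lt_pow_right (by norm_num) (by omega)))
    have hx : (n ||| touched v (f v) slots) >>> C ∈ expand C (options C v slots) l := by
      -- Color `k` is listed at position `k - 1`.
      refine mem_expand.2 ⟨_, mem_options.2 ⟨f v - 1, by omega, rfl⟩, n, hn, ?_, ?_⟩
      · rw [Nat.and_two_pow]
        cases hb : n.testBit (f v - 1) with
        | false => simp
        | true =>
          obtain ⟨p, hp, hh⟩ := hng _ hb
          exact absurd hh (hnot p hp)
      · rw [Nat.sub_add_cancel hf1]
    have hxg : Good f U (slots.drop C) ((n ||| touched v (f v) slots) >>> C) := by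
      intro j hj
      rw [Nat.testBit_shiftRight, Nat.testBit_or, Bool.or_eq_true] at hj
      rw [List.getElem?_drop]
      rcases hj with hj | hj
      · exact hng _ hj
      · obtain ⟨p, hp, hk, hb⟩ := testBit_touched hj
        exact ⟨p, hp, v, hv, hb, hk.symm⟩
    -- Widths exceed the number of slots by one. The spare digit is never set in a good state, so a
    -- good state is not all ones.
    obtain ⟨y, hy, hyx⟩ := exists_mem_prune (K := List.rec K' (fun _ _ _ => K) t) _ hbound hx (by
      intro h
      obtain ⟨p, hp, -⟩ := hxg (slots.drop C).length (by rw [h, Nat.testBit_two_pow_sub_one]; simp)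
      rw [List.getElem?_eq_none le_rfl] at hp
      simp at hp)
    obtain ⟨z, hz, hzg⟩ := ih (slots.drop C)
      (prune ((slots.drop C).length + 1) (List.rec K' (fun _ _ _ => K) t) (expand C (options C v slots) l))
      hfit (fun x hx => hbound x (prune_subset hx)) ⟨y, hy, fun j hj => hxg j (hyx j hj)⟩
    refine ⟨z, by rw [sweep_cons, hw]; exact hz, ?_⟩
    rw [List.drop_drop] at hzg
    rwa [List.length_cons, Nat.mul_succ, add_comm]

/-! ### Balls and slots from a list of edges -/

/-- The set `m` together with its neighbors along the edges `es`. -/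
def next (es : List (ℕ × ℕ)) (m : ℕ) : ℕ :=
  List.rec (motive := fun _ => ℕ → ℕ) (fun a => a) (fun e _ ih a =>
    force (Nat.lor (Nat.lor a (Nat.shiftLeft (Nat.land (Nat.shiftRight m e.1) (nat_lit 1)) e.2))
      (Nat.shiftLeft (Nat.land (Nat.shiftRight m e.2) (nat_lit 1)) e.1)) ih) es m

theorem testBit_bit_shift {m a b v : ℕ} :
    (((m >>> a) &&& 1) <<< b).testBit v = (decide (v = b) && m.testBit a) := by
  have h : ((m >>> a) &&& 1) = if m.testBit a then 1 else 0 := by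
    rw [Nat.and_one_is_mod, Nat.testBit_eq_decide_div_mod_eq, Nat.shiftRight_eq_div_pow]
    rcases Nat.mod_two_eq_zero_or_one (m / 2 ^ a) with h | h <;> simp [h]
  rw [h]
  split_ifs with hm
  · rw [Nat.one_shiftLeft, Nat.testBit_two_pow]
    simp [hm, eq_comm]
  · simp [hm]

/-- Neighbors are read off the fixed set `m` and not the accumulator, so one pass enlarges the
radius by exactly one, whatever the order of the edges. -/
theorem testBit_next {es : List (ℕ × ℕ)} {m v : ℕ} : (next es m).testBit v ↔
    m.testBit v ∨ ∃ u, m.testBit u ∧ ((u, v) ∈ es ∨ (v, u) ∈ es) := by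
  let go : List (ℕ × ℕ) → ℕ → ℕ := fun es => List.rec (motive := fun _ => ℕ → ℕ) (fun a => a)
    (fun e _ ih a => force (Nat.lor (Nat.lor a
      (Nat.shiftLeft (Nat.land (Nat.shiftRight m e.1) (nat_lit 1)) e.2))
      (Nat.shiftLeft (Nat.land (Nat.shiftRight m e.2) (nat_lit 1)) e.1)) ih) es
  have key : ∀ es a, (go es a).testBit v ↔
      a.testBit v ∨ ∃ u, m.testBit u ∧ ((u, v) ∈ es ∨ (v, u) ∈ es) := by
    intro es
    induction es with
    | nil => intro a; simp [go]
    | cons e es ih =>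
      intro a
      refine (ih ((a ||| ((m >>> e.1) &&& 1) <<< e.2) ||| ((m >>> e.2) &&& 1) <<< e.1)).trans ?_
      simp only [Nat.testBit_or, Bool.or_eq_true, testBit_bit_shift, Bool.and_eq_true,
        decide_eq_true_eq, List.mem_cons, Prod.ext_iff]
      constructor
      · rintro (((h | ⟨rfl, h⟩) | ⟨rfl, h⟩) | ⟨u, hu, h⟩)
        · exact Or.inl h
        · exact Or.inr ⟨_, h, Or.inl (Or.inl ⟨rfl, rfl⟩)⟩
        · exact Or.inr ⟨_, h, Or.inr (Or.inl ⟨rfl, rfl⟩)⟩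
        · exact Or.inr ⟨u, hu, by tauto⟩
      · rintro (h | ⟨u, hu, (⟨rfl, rfl⟩ | h) | (⟨rfl, rfl⟩ | h)⟩)
        · tauto
        · tauto
        · exact Or.inr ⟨_, hu, Or.inl h⟩
        · tauto
        · exact Or.inr ⟨_, hu, Or.inr h⟩
  exact key es m

/-- The set of vertices within distance `d` of `u` along the edges `es`. -/
def ball (es : List (ℕ × ℕ)) (u d : ℕ) : ℕ :=
  Nat.rec (Nat.shiftLeft (nat_lit 1) u) (fun _ m => next es m) d

theorem ball_zero (es : List (ℕ × ℕ)) (u : ℕ) : ball es u 0 = 2 ^ u := Nat.one_shiftLeft u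

theorem ball_succ (es : List (ℕ × ℕ)) (u d : ℕ) : ball es u (d + 1) = next es (ball es u d) := rfl

theorem testBit_ball_self (es : List (ℕ × ℕ)) (u d : ℕ) : (ball es u d).testBit u := by
  induction d with
  | zero => simp [ball_zero]
  | succ d ih => rw [ball_succ, testBit_next]; exact Or.inl ih

/-- The slots of a vertex `u`: for each color `k ≤ C` the other vertices within distance `k`. -/
def vertexSlots (es : List (ℕ × ℕ)) (C u : ℕ) (tail : List (ℕ × ℕ)) : List (ℕ × ℕ) :=
  Nat.rec (motive := fun _ => ℕ → List (ℕ × ℕ)) (fun _ => tail) (fun _ ih i =>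
    force (Nat.add i (nat_lit 1)) fun k =>
      (k, Nat.xor (ball es u k) (Nat.shiftLeft (nat_lit 1) u)) :: ih k) C (nat_lit 0)

theorem vertexSlots_eq (es : List (ℕ × ℕ)) (C u : ℕ) (tail : List (ℕ × ℕ)) :
    vertexSlots es C u tail =
      (List.range' 1 C).map (fun k => (k, ball es u k ^^^ 2 ^ u)) ++ tail := by
  let go : ℕ → ℕ → List (ℕ × ℕ) := fun n => Nat.rec (motive := fun _ => ℕ → List (ℕ × ℕ))
    (fun _ => tail) (fun _ ih i => force (Nat.add i (nat_lit 1)) fun k =>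
      (k, Nat.xor (ball es u k) (Nat.shiftLeft (nat_lit 1) u)) :: ih k) n
  have key : ∀ n i, go n i =
      (List.range' (i + 1) n).map (fun k => (k, ball es u k ^^^ 2 ^ u)) ++ tail := by
    intro n
    induction n with
    | zero => intro i; rfl
    | succ n ih =>
      intro i
      change (i + 1, ball es u (i + 1) ^^^ (1 <<< u)) :: go n (i + 1) = _
      rw [ih, Nat.one_shiftLeft]
      rfl
  exact key C 0

/-- The slots of the vertices `vs`, followed by the slots `tail`. -/
def allSlots (es : List (ℕ × ℕ)) (C : ℕ) (vs : List ℕ) (tail : List (ℕ × ℕ)) : List (ℕ × ℕ) :=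
  List.rec tail (fun u _ ih => vertexSlots es C u ih) vs

theorem drop_vertexSlots (es : List (ℕ × ℕ)) (C u : ℕ) (tail : List (ℕ × ℕ)) :
    (vertexSlots es C u tail).drop C = tail := by
  rw [vertexSlots_eq, List.drop_append_of_le_length (by simp)]
  simp

theorem drop_allSlots (es : List (ℕ × ℕ)) (C : ℕ) (vs : List ℕ) (tail : List (ℕ × ℕ)) :
    (allSlots es C vs tail).drop (C * vs.length) = tail := by
  induction vs with
  | nil => simp [allSlots]
  | cons u vs ih =>
    change (vertexSlots es C u (allSlots es C vs tail)).drop _ = _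
    rw [List.length_cons, Nat.mul_succ, add_comm, ← List.drop_drop, drop_vertexSlots, ih]

def len {α : Type} (l : List α) : ℕ :=
  List.rec (motive := fun _ => ℕ → ℕ) (fun n => n)
    (fun _ _ ih n => force (Nat.add n (nat_lit 1)) ih) l (nat_lit 0)

theorem len_eq {α : Type} (l : List α) : len l = l.length := by
  let go : List α → ℕ → ℕ := fun l => List.rec (motive := fun _ => ℕ → ℕ) (fun n => n)
    (fun _ _ ih n => force (Nat.add n (nat_lit 1)) ih) l
  have key : ∀ (l : List α) n, go l n = n + l.length := by
    intro l
    induction l with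
    | nil => intro n; rfl
    | cons x l ih => intro n; exact (ih (n + 1)).trans (by rw [List.length_cons]; omega)
  exact (key l 0).trans (zero_add _)

/-- The states of all colorings of `vs` with `C` colors, recording the slots `out`. -/
def states (es : List (ℕ × ℕ)) (C K K' : ℕ) (vs : List ℕ) (out : List (ℕ × ℕ)) : List ℕ :=
  forcePairs (allSlots es C vs out) fun slots =>
    force (Nat.add (len slots) (nat_lit 1)) fun w => sweep C K K' vs slots w [nat_lit 0]

/-! ### Every packing coloring is represented by a state -/

section Graph

variable {V : Type*} {G : SimpleGraph V} {φ : ℕ → V} {es : List (ℕ × ℕ)}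

theorem edist_le_of_testBit_ball (hes : ∀ e ∈ es, G.Adj (φ e.1) (φ e.2)) {u v d : ℕ}
    (h : (ball es u d).testBit v) : G.edist (φ u) (φ v) ≤ d := by
  induction d generalizing v with
  | zero =>
    rw [ball_zero, Nat.testBit_two_pow, decide_eq_true_eq] at h
    simp [h]
  | succ d ih =>
    rw [ball_succ, testBit_next] at h
    rcases h with h | ⟨w, hw, h⟩
    · exact (ih h).trans (by norm_cast; omega)
    · have hadj : G.Adj (φ w) (φ v) := h.elim (fun h => hes _ h) (fun h => (hes _ h).symm)
      refine G.edist_triangle.trans ((add_le_add (ih hw) (SimpleGraph.edist_eq_one_iff_adj.2 hadj).le).trans ?_)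
      norm_cast

/-- `f` colors the vertices `φ u`, `u ∈ U`, with `1, …, C`, and those of the same color `k` are
at distance greater than `k`. -/
structure IsPackingOn (G : SimpleGraph V) (φ : ℕ → V) (f : ℕ → ℕ) (C : ℕ) (U : List ℕ) : Prop where
  one_le : ∀ u ∈ U, 1 ≤ f u
  le : ∀ u ∈ U, f u ≤ C
  lt_edist : ∀ u ∈ U, ∀ v ∈ U, u ≠ v → f u = f v → (f u : ℕ∞) < G.edist (φ u) (φ v)

theorem IsPackingOn.mono {f : ℕ → ℕ} {C : ℕ} {U U' : List ℕ} (h : IsPackingOn G φ f C U)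
    (hU : ∀ u ∈ U', u ∈ U) : IsPackingOn G φ f C U' :=
  ⟨fun u hu => h.one_le u (hU u hu), fun u hu => h.le u (hU u hu),
    fun u hu v hv => h.lt_edist u (hU u hu) v (hU v hv)⟩

/-- Balls along `es` lie inside the true balls, so a hit on the slot of `u` for its own color would
be a second vertex of that color too close to `u`. The edges need not be complete for this. -/
theorem fits_allSlots (hes : ∀ e ∈ es, G.Adj (φ e.1) (φ e.2)) {f : ℕ → ℕ} {C : ℕ} {U : List ℕ}
    (hf : IsPackingOn G φ f C U) (out : List (ℕ × ℕ)) (vs : List ℕ) (hvs : ∀ v ∈ vs, v ∈ U) :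
    Fits f U C vs (allSlots es C vs out) := by
  induction vs with
  | nil => trivial
  | cons u vs ih =>
    have hu := hvs u (by simp)
    have h1 := hf.one_le u hu
    have hC := hf.le u hu
    refine ⟨hu, ⟨h1, hC⟩, ?_, ?_, ?_⟩
    · change C ≤ (vertexSlots es C u (allSlots es C vs out)).length
      rw [vertexSlots_eq]; simp
    · intro p hp
      change (vertexSlots es C u (allSlots es C vs out))[f u - 1]? = _ at hp
      rw [vertexSlots_eq, List.getElem?_append_left (by simp; omega), List.getElem?_map,
        List.getElem?_range' (by omega)] at hp
      simp only [Option.map_some, Option.some.injEq] at hp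
      rw [one_mul, show 1 + (f u - 1) = f u by omega] at hp
      rintro ⟨v, hv, hb, hfv⟩
      rw [← hp] at hb hfv
      simp only at hb hfv
      have huv : u ≠ v := by
        rintro rfl
        rw [Nat.testBit_xor, testBit_ball_self] at hb
        simp at hb
      rw [Nat.testBit_xor, Nat.testBit_two_pow_of_ne huv, Bool.xor_false] at hb
      exact absurd (edist_le_of_testBit_ball hes hb) (not_le.2 (hf.lt_edist u hu v hv huv hfv.symm))
    · change Fits f U C vs ((vertexSlots es C u (allSlots es C vs out)).drop C)
      rw [drop_vertexSlots]
      exact ih fun v hv => hvs v (by simp [hv])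

theorem exists_mem_states (hes : ∀ e ∈ es, G.Adj (φ e.1) (φ e.2)) {f : ℕ → ℕ} {C K K' : ℕ}
    {vs : List ℕ} (hf : IsPackingOn G φ f C vs) (out : List (ℕ × ℕ)) :
    ∃ n ∈ states es C K K' vs out, Good f vs out n := by
  have h := exists_mem_sweep (K := K) (K' := K') vs (allSlots es C vs out) [0]
    (fits_allSlots hes hf out vs fun _ h => h) (by simp) ⟨0, by simp, fun j hj => by simp at hj⟩
  rw [drop_allSlots, ← len_eq] at h
  rw [states, forcePairs_eq, force_eq]
  exact h

end Graph

/-! ### Joining the states of three blocks -/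

/-- A tree of numbers; every inner node carries digits common to all numbers below it. -/
inductive Tree
  | leaf (x : ℕ)
  | node (m : ℕ) (t u : Tree)

namespace Tree

def mask (t : Tree) : ℕ := Tree.rec (fun x => x) (fun m _ _ _ _ => m) t

def leaves : Tree → List ℕ
  | leaf x => [x]
  | node _ t u => t.leaves ++ u.leaves

def Valid : Tree → Prop
  | leaf _ => True
  | node m t u => (∀ x ∈ t.leaves ++ u.leaves, Sub m x) ∧ t.Valid ∧ u.Valid

theorem Valid.sub_mask {t : Tree} (h : t.Valid) {x : ℕ} (hx : x ∈ t.leaves) : Sub t.mask x := by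
  cases t with
  | leaf y => rw [List.mem_singleton.1 hx]; exact fun _ h => h
  | node m t u => exact h.1 x hx

/-- The leaves of `t` disjoint from `p`, followed by `o`. -/
def query (p : ℕ) (t : Tree) : List ℕ → List ℕ :=
  Tree.rec (fun x o => Nat.rec (x :: o) (fun _ _ => o) (Nat.land x p))
    (fun m _ _ iht ihu o =>
      Nat.rec (delay (iht (delay (ihu o)))) (fun _ _ => o) (Nat.land m p)) t

theorem query_leaf (p x : ℕ) (o : List ℕ) :
    (leaf x).query p o = if x &&& p = 0 then x :: o else o := by
  change Nat.rec (motive := fun _ => List ℕ) (x :: o) (fun _ _ => o) (x &&& p) = _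
  cases x &&& p <;> simp

theorem query_node (p m : ℕ) (t u : Tree) (o : List ℕ) :
    (node m t u).query p o = if m &&& p = 0 then t.query p (u.query p o) else o := by
  change Nat.rec (motive := fun _ => List ℕ) (t.query p (u.query p o)) (fun _ _ => o) (m &&& p) = _
  cases m &&& p <;> simp

theorem subset_query (p : ℕ) (t : Tree) {o : List ℕ} {x : ℕ} (hx : x ∈ o) : x ∈ t.query p o := by
  induction t generalizing o with
  | leaf y => rw [query_leaf]; split_ifs <;> simp [hx]
  | node m t u iht ihu => rw [query_node]; split_ifs; exacts [iht (ihu hx), hx]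

/-- A mask meeting `p` forces every leaf below to meet `p`, so the subtrees skipped contain no
answer. -/
theorem mem_query {p : ℕ} {t : Tree} (ht : t.Valid) {o : List ℕ} {x : ℕ} (hx : x ∈ t.leaves)
    (hp : x &&& p = 0) : x ∈ t.query p o := by
  induction t generalizing o with
  | leaf y =>
    rw [List.mem_singleton.1 hx] at hp ⊢
    rw [query_leaf, if_pos hp]
    simp
  | node m t u iht ihu =>
    have hm : m &&& p = 0 := by
      apply Nat.eq_of_testBit_eq
      intro i
      have h1 := ht.1 x hx i
      have h2 := congrArg (fun n => n.testBit i) hp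
      simp only [Nat.testBit_and, Nat.zero_testBit, Bool.and_eq_false_iff] at h2 ⊢
      rcases h2 with h2 | h2
      · left; by_contra hne; simp [h1 (by simpa using hne)] at h2
      · exact Or.inr h2
    rw [query_node, if_pos hm]
    rcases List.mem_append.1 hx with hx | hx
    · exact iht ht.2.1 hx
    · exact subset_query p t (ihu ht.2.2 hx)

end Tree

/-- The mask of a node is the intersection of the masks of its children, hence contained in every
leaf below. -/
def pairUp (l : List Tree) : List Tree :=
  List.rec (fun o => o) (fun x _ ih (o : List Tree) =>
    List.rec (ih [x]) (fun y _ _ =>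
      force (Nat.land (Tree.mask x) (Tree.mask y)) fun m => Tree.node m y x :: ih []) o) l []

theorem pairUp_spec (l : List Tree) (hl : ∀ t ∈ l, t.Valid) :
    (∀ t ∈ pairUp l, t.Valid) ∧ ∀ x, (∃ t ∈ l, x ∈ t.leaves) → ∃ t ∈ pairUp l, x ∈ t.leaves := by
  let go : List Tree → List Tree → List Tree := fun l =>
    List.rec (fun o => o) (fun x _ ih (o : List Tree) =>
      List.rec (ih [x]) (fun y _ _ =>
        force (Nat.land (Tree.mask x) (Tree.mask y)) fun m => Tree.node m y x :: ih []) o) l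
  have key : ∀ l o : List Tree, o.length ≤ 1 → (∀ t ∈ l, t.Valid) → (∀ t ∈ o, t.Valid) →
      (∀ t ∈ go l o, t.Valid) ∧
        ∀ x, (∃ t ∈ o ++ l, x ∈ t.leaves) → ∃ t ∈ go l o, x ∈ t.leaves := by
    intro l
    induction l with
    | nil => intro o _ _ h; exact ⟨h, fun x h => by simpa using h⟩
    | cons x l ih =>
      intro o ho hl hv
      have hx := hl x (by simp)
      have hl' : ∀ t ∈ l, t.Valid := fun t ht => hl t (by simp [ht])
      match o, ho with
      | [], _ => exact ih [x] (by simp) hl' (by simpa using hx)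
      | [y], _ =>
        have hy := hv y (by simp)
        obtain ⟨h1, h2⟩ := ih [] (by simp) hl' (by simp)
        have hgo : go (x :: l) [y] = Tree.node (x.mask &&& y.mask) y x :: go l [] := rfl
        rw [hgo]
        refine ⟨fun t ht => ?_, fun z hz => ?_⟩
        · rcases List.mem_cons.1 ht with rfl | ht
          · refine ⟨fun z hz i hi => ?_, hy, hx⟩
            rw [Nat.testBit_and, Bool.and_eq_true] at hi
            rcases List.mem_append.1 hz with hz | hz
            · exact hy.sub_mask hz i hi.2
            · exact hx.sub_mask hz i hi.1
          · exact h1 t ht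
        · obtain ⟨t, ht, hzt⟩ := hz
          simp only [List.singleton_append, List.mem_cons] at ht
          rcases ht with rfl | rfl | ht
          · exact ⟨_, List.mem_cons_self, List.mem_append_left _ hzt⟩
          · exact ⟨_, List.mem_cons_self, List.mem_append_right _ hzt⟩
          · obtain ⟨u, hu, hzu⟩ := h2 z ⟨t, ht, hzt⟩
            exact ⟨u, List.mem_cons_of_mem _ hu, hzu⟩
  exact key l [] (by simp) hl (by simp)

def forceTrees {α : Type} (l : List Tree) : (List Tree → α) → α :=
  List.rec (fun k => k []) (fun x _ ih k => delay (ih fun t => delay (k (x :: t)))) l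

theorem forceTrees_eq {α : Type} (l : List Tree) (k : List Tree → α) : forceTrees l k = k l := by
  induction l generalizing k with
  | nil => rfl
  | cons x l ih => exact ih _

def toLeaves (l : List ℕ) : List Tree := List.rec [] (fun x _ ih => Tree.leaf x :: ih) l

/-- `k` applied to a list of at most `length l / 2 ^ n` trees, rounded up, with the leaves `l`. -/
def forest {α : Type} (n : ℕ) : List Tree → (List Tree → α) → α :=
  Nat.rec (fun l k => k l) (fun _ ih l k => forceTrees (pairUp l) fun t => ih t k) n

theorem exists_forest_eq {α : Type} (n : ℕ) (l : List ℕ) (k : List Tree → α) :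
    ∃ ts, forest n (toLeaves l) k = k ts ∧ (∀ t ∈ ts, t.Valid) ∧
      ∀ x ∈ l, ∃ t ∈ ts, x ∈ t.leaves := by
  have key : ∀ n (l : List Tree), (∀ t ∈ l, t.Valid) → ∃ ts, forest n l k = k ts ∧
      (∀ t ∈ ts, t.Valid) ∧ ∀ x, (∃ t ∈ l, x ∈ t.leaves) → ∃ t ∈ ts, x ∈ t.leaves := by
    intro n
    induction n with
    | zero => exact fun l hl => ⟨l, rfl, hl, fun _ h => h⟩
    | succ n ih =>
      intro l hl
      obtain ⟨h1, h2⟩ := pairUp_spec l hl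
      obtain ⟨ts, h3, h4, h5⟩ := ih (pairUp l) h1
      exact ⟨ts, (forceTrees_eq _ _).trans h3, h4, fun x hx => h5 x (h2 x hx)⟩
  have hmem : ∀ x ∈ l, Tree.leaf x ∈ toLeaves l := by
    induction l with
    | nil => simp
    | cons y l ih =>
      intro x hx
      change _ ∈ Tree.leaf y :: toLeaves l
      rcases List.mem_cons.1 hx with rfl | hx
      · simp
      · exact List.mem_cons_of_mem _ (ih x hx)
  have hval : ∀ t ∈ toLeaves l, t.Valid := by
    clear hmem
    induction l with
    | nil => intro t ht; simp [toLeaves] at ht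
    | cons y l ih =>
      intro t ht
      change t ∈ Tree.leaf y :: toLeaves l at ht
      rcases List.mem_cons.1 ht with rfl | ht
      · trivial
      · exact ih t ht
  obtain ⟨ts, h1, h2, h3⟩ := key n _ hval
  exact ⟨ts, h1, h2, fun x hx => h3 x ⟨_, hmem x hx, by simp [Tree.leaves]⟩⟩

def queryAll (p : ℕ) (l : List Tree) : List ℕ := List.rec [] (fun t _ ih => Tree.query p t ih) l

theorem mem_queryAll {p x : ℕ} {l : List Tree} (hl : ∀ t ∈ l, t.Valid)
    (hx : ∃ t ∈ l, x ∈ t.leaves) (hp : x &&& p = 0) : x ∈ queryAll p l := by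
  induction l with
  | nil => simp at hx
  | cons t l ih =>
    change x ∈ t.query p (queryAll p l)
    obtain ⟨u, hu, hxu⟩ := hx
    rcases List.mem_cons.1 hu with rfl | hu
    · exact Tree.mem_query (hl u (by simp)) hxu hp
    · exact Tree.subset_query p t (ih (fun t ht => hl t (by simp [ht])) ⟨u, hu, hxu⟩)

/-- The numbers `x &&& m`, `x ∈ l`, in lanes of `s` bits. -/
def pack (s m : ℕ) (l : List ℕ) : ℕ :=
  List.rec (motive := fun _ => ℕ → ℕ) (fun n => n)
    (fun x _ ih n => force (Nat.add (Nat.shiftLeft n s) (Nat.land x m)) ih) l (nat_lit 0)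

/-- A lowest bit for each element of `l`, in lanes of `s` bits. -/
def packOnes (s : ℕ) (l : List ℕ) : ℕ :=
  List.rec (motive := fun _ => ℕ → ℕ) (fun n => n)
    (fun _ _ ih n => force (Nat.add (Nat.shiftLeft n s) (nat_lit 1)) ih) l (nat_lit 0)

theorem pack_eq (s m : ℕ) (l : List ℕ) : pack s m l = packed s (l.map (· &&& m)).reverse := by
  let go : List ℕ → ℕ → ℕ := fun l => List.rec (motive := fun _ => ℕ → ℕ) (fun n => n)
    (fun x _ ih n => force (Nat.add (Nat.shiftLeft n s) (Nat.land x m)) ih) l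
  have key : ∀ (l acc : List ℕ), go l (packed s acc) = packed s ((l.map (· &&& m)).reverse ++ acc) := by
    intro l
    induction l with
    | nil => intro acc; rfl
    | cons x l ih =>
      intro acc
      change go l ((packed s acc <<< s) + (x &&& m)) = _
      rw [Nat.shiftLeft_eq, add_comm, mul_comm]
      exact (ih ((x &&& m) :: acc)).trans (by simp)
  have := key l []
  rw [List.append_nil] at this
  exact this

theorem packOnes_eq (s : ℕ) (l l' : List ℕ) (h : l'.length = l.length) :
    packOnes s l = packed s (l'.map fun _ => 1) := by
  let go : List ℕ → ℕ → ℕ := fun l => List.rec (motive := fun _ => ℕ → ℕ) (fun n => n)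
    (fun _ _ ih n => force (Nat.add (Nat.shiftLeft n s) (nat_lit 1)) ih) l
  have key : ∀ (l : List ℕ) (a : ℕ), go l (packed s (List.replicate a 1)) =
      packed s (List.replicate (a + l.length) 1) := by
    intro l
    induction l with
    | nil => intro a; rfl
    | cons x l ih =>
      intro a
      change go l ((packed s (List.replicate a 1) <<< s) + 1) = _
      rw [Nat.shiftLeft_eq, add_comm, mul_comm, List.length_cons,
        show a + (l.length + 1) = (a + 1) + l.length by ring, ← ih]
      rfl
  rw [List.map_const', h]
  have := key l 0
  rw [zero_add] at this
  exact this

/-- Whether `x` contains an element of `g`. -/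
def containsAny (g : List ℕ) (x : ℕ) : Bool :=
  List.rec false (fun y _ ih => Bool.rec ih true (Nat.beq (Nat.land x y) y)) g

theorem exists_of_containsAny {g : List ℕ} {x : ℕ} (h : containsAny g x = true) :
    ∃ y ∈ g, Sub y x := by
  induction g with
  | nil => simp [containsAny] at h
  | cons y g ih =>
    change Bool.rec (motive := fun _ => Bool) (containsAny g x) true (Nat.beq (x &&& y) y) = true at h
    cases hb : Nat.beq (x &&& y) y with
    | false =>
      rw [hb] at h
      obtain ⟨z, hz, hs⟩ := ih h
      exact ⟨z, by simp [hz], hs⟩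
    | true =>
      refine ⟨y, by simp, fun i hi => ?_⟩
      rw [← Nat.eq_of_beq_eq_true hb, Nat.testBit_and, Bool.and_eq_true] at hi
      exact hi.1

/-- Whether `v ||| r` contains an element of `g` for all `r ∈ lb` disjoint from `q`. -/
def checkThird (g : List ℕ) (v q : ℕ) (lb : List ℕ) : Bool :=
  List.rec true (fun r _ ih =>
    Nat.rec (Bool.rec false ih (containsAny g (Nat.lor v r))) (fun _ _ => ih) (Nat.land r q)) lb

theorem exists_of_checkThird {g : List ℕ} {v q : ℕ} {lb : List ℕ} (h : checkThird g v q lb = true)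
    {r : ℕ} (hr : r ∈ lb) (hq : r &&& q = 0) : ∃ y ∈ g, Sub y (v ||| r) := by
  induction lb with
  | nil => simp at hr
  | cons z lb ih =>
    change Nat.rec (motive := fun _ => Bool) (Bool.rec (motive := fun _ => Bool) false
      (checkThird g v q lb) (containsAny g (v ||| z))) (fun _ _ => checkThird g v q lb) (z &&& q) = true at h
    cases hz : z &&& q with
    | zero =>
      rw [hz] at h
      cases hc : containsAny g (v ||| z) with
      | false => rw [hc] at h; simp at h
      | true =>
        rw [hc] at h
        rcases List.mem_cons.1 hr with rfl | hr
        · exact exists_of_containsAny hc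
        · exact ih h hr
    | succ n =>
      rw [hz] at h
      rcases List.mem_cons.1 hr with rfl | hr
      · rw [hq] at hz; simp at hz
      · exact ih h hr

/-- `checkThird` for `v = a ||| s` and `q = v &&& m` for all `s ∈ le` for which the lanes of `W`
do not all meet `q`. -/
def checkLanes (R M H W m : ℕ) (g : List ℕ) (a : ℕ) (lb le : List ℕ) : Bool :=
  List.rec true (fun s _ ih =>
    force (Nat.lor a s) fun v => force (Nat.land v m) fun q =>
    Bool.rec (Bool.rec false ih (checkThird g v q lb)) ih (allMeet R M H W q)) le

def checkSecond (w m : ℕ) (g : List ℕ) (a : ℕ) (le lb : List ℕ) : Bool :=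
  force (pack (Nat.add w 1) m lb) fun W => force (packOnes (Nat.add w 1) lb) fun R =>
  force (Nat.mul R (Nat.sub (Nat.shiftLeft 1 w) 1)) fun M =>
  force (Nat.mul R (Nat.shiftLeft 1 w)) fun H => checkLanes R M H W m g a lb le

/-- If all lanes meet `q`, no `r` is compatible with the pair `a`, `s`, and the pair needs no check;
otherwise `checkThird` runs through the compatible `r`. -/
theorem exists_of_checkSecond {w m : ℕ} (hm : m < 2 ^ w) {g : List ℕ} {a : ℕ} {le lb : List ℕ}
    (h : checkSecond w m g a le lb = true) {s r : ℕ} (hs : s ∈ le) (hr : r ∈ lb)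
    (hq : r &&& ((a ||| s) &&& m) = 0) : ∃ y ∈ g, Sub y (a ||| s ||| r) := by
  have h2w : Nat.shiftLeft 1 w = 2 ^ w := Nat.one_shiftLeft w
  set l := (lb.map (· &&& m)).reverse with hl
  have hR : packOnes (w + 1) lb = packed (w + 1) (l.map fun _ => 1) :=
    packOnes_eq _ _ _ (by simp [hl])
  have hlw : ∀ x ∈ l, x < 2 ^ w := by
    intro x hx
    rw [hl, List.mem_reverse, List.mem_map] at hx
    obtain ⟨y, -, rfl⟩ := hx
    exact lt_of_le_of_lt Nat.and_le_right hm
  unfold checkSecond at h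
  simp only [force_eq, h2w] at h
  rw [show Nat.add w 1 = w + 1 from rfl, pack_eq, ← hl, hR] at h
  induction le with
  | nil => simp at hs
  | cons z le ih =>
    set c := checkLanes (packed (w + 1) (l.map fun _ => 1))
      (packed (w + 1) (l.map fun _ => 1) * (2 ^ w - 1)) (packed (w + 1) (l.map fun _ => 1) * 2 ^ w)
      (packed (w + 1) l) m g a lb le with hc
    change Bool.rec (motive := fun _ => Bool) (Bool.rec (motive := fun _ => Bool) false c
      (checkThird g (a ||| z) ((a ||| z) &&& m) lb)) c (allMeet (packed (w + 1) (l.map fun _ => 1))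
      (packed (w + 1) (l.map fun _ => 1) * (2 ^ w - 1)) (packed (w + 1) (l.map fun _ => 1) * 2 ^ w)
      (packed (w + 1) l) ((a ||| z) &&& m)) = true at h
    have hmeet := allMeet_packed (lt_of_le_of_lt (Nat.and_le_right (n := a ||| z)) hm) l hlw
    cases hb : allMeet (packed (w + 1) (l.map fun _ => 1))
      (packed (w + 1) (l.map fun _ => 1) * (2 ^ w - 1)) (packed (w + 1) (l.map fun _ => 1) * 2 ^ w)
      (packed (w + 1) l) ((a ||| z) &&& m) with
    | true =>
      rw [hb] at h
      rcases List.mem_cons.1 hs with rfl | hs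
      · refine absurd ?_ (hmeet.1 hb (r &&& m) (by simpa [hl] using ⟨r, hr, rfl⟩))
        rw [Nat.and_comm r, Nat.and_assoc, ← Nat.and_assoc m, Nat.and_self, Nat.and_comm m r,
          Nat.and_left_comm, hq]
      · exact ih hs h
    | false =>
      rw [hb] at h
      cases ht : checkThird g (a ||| z) ((a ||| z) &&& m) lb with
      | false => rw [ht] at h; simp at h
      | true =>
        rw [ht] at h
        rcases List.mem_cons.1 hs with rfl | hs
        · exact exists_of_checkThird ht hr hq
        · exact ih hs h

/-- Whether `a ||| s ||| r` contains an element of `g` for all `a ∈ A` and leaves `s`, `r` of `tE`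
and `tB`, unless `a`, `s` or `a`, `r` or `a ||| s`, `r` meet within `m₂`, `m₁` or `m`. -/
def checkFirst (w m₁ m₂ m : ℕ) (g : List ℕ) (tE tB : List Tree) (A : List ℕ) : Bool :=
  List.rec true (fun a _ ih =>
    force (Nat.land a m₂) fun p => force (Nat.land a m₁) fun q =>
     Bool.rec false ih (List.rec true (fun _ _ _ =>
      checkSecond w m g a (queryAll p tE) (queryAll q tB)) (queryAll p tE))) A

theorem exists_of_checkFirst {w m₁ m₂ m : ℕ} (hm : m < 2 ^ w) {g : List ℕ} {tE tB : List Tree}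
    {A : List ℕ} (hE : ∀ t ∈ tE, t.Valid) (hB : ∀ t ∈ tB, t.Valid)
    (h : checkFirst w m₁ m₂ m g tE tB A = true) {a s r : ℕ} (ha : a ∈ A)
    (hs : ∃ t ∈ tE, s ∈ t.leaves) (hr : ∃ t ∈ tB, r ∈ t.leaves) (h2 : s &&& (a &&& m₂) = 0)
    (h1 : r &&& (a &&& m₁) = 0) (hq : r &&& ((a ||| s) &&& m) = 0) :
    ∃ y ∈ g, Sub y (a ||| s ||| r) := by
  induction A with
  | nil => simp at ha
  | cons z A ih =>
    change Bool.rec (motive := fun _ => Bool) false (checkFirst w m₁ m₂ m g tE tB A)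
      (List.rec true (fun _ _ _ => checkSecond w m g z (queryAll (z &&& m₂) tE)
        (queryAll (z &&& m₁) tB)) (queryAll (z &&& m₂) tE)) = true at h
    generalize hc : (List.rec true (fun _ _ _ => checkSecond w m g z (queryAll (z &&& m₂) tE)
        (queryAll (z &&& m₁) tB)) (queryAll (z &&& m₂) tE) : Bool) = c at h
    cases c with
    | false => simp at h
    | true =>
      rcases List.mem_cons.1 ha with rfl | ha
      · have hs' := mem_queryAll hE hs h2
        have hr' := mem_queryAll hB hr h1
        cases hl : queryAll (a &&& m₂) tE with
        | nil => rw [hl] at hs'; simp at hs'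
        | cons y l =>
          rw [hl] at hc hs'
          exact exists_of_checkSecond hm hc hs' hr' hq
      · exact ih h ha

/-! ### Patterns near the corners of a copy -/

/-- The triples `(n, k, e)`: whether a vertex of color `k` is within distance `e` of the `n`-th
corner. The corners `3` and `4` are those towards the other copies. -/
def layout : List (ℕ × ℕ × ℕ) :=
  [0, 1, 2, 3, 4, 5, 6].flatMap fun e => [7, 6, 5, 4, 3, 2].flatMap fun k =>
    ([0, 1, 2, 3, 4].filter fun n => e < k ∧ (n < 3 ∨ k = 2 ∨ k = 5 ∨ k = 6)).map fun n => (n, k, e)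

/-- The slots of the layout for a block: the `n`-th corner is ignored if its mode is `0`, a vertex of
color `k` counts within distance `e` if its mode is `1`, and within distance `k - e` otherwise. -/
def outSlots (es : List (ℕ × ℕ)) (corners modes : List ℕ) : List (ℕ × ℕ) :=
  layout.map fun x => (x.2.1, Nat.rec (nat_lit 0)
    (fun m _ => Nat.rec (ball es (corners.getD x.1 0) x.2.2)
      (fun _ _ => ball es (corners.getD x.1 0) (Nat.sub x.2.1 x.2.2)) m) (modes.getD x.1 0))

/-- The digits of the layout for the corner `n`. -/
def cornerMask (n : ℕ) : ℕ := touched 0 n (layout.map fun x => (x.1, 1))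

/-- The number of digits of the layout. -/
def width : ℕ := 107

theorem cornerMask_lt (n : ℕ) : cornerMask n < 2 ^ width := by
  have h : (layout.map fun x => (x.1, 1)).length = width := by decide +kernel
  rw [← h]
  exact touched_lt _ _ _

theorem layout_of_testBit_cornerMask {n j : ℕ} (h : (cornerMask n).testBit j) {x : ℕ × ℕ × ℕ}
    (hx : layout[j]? = some x) : x.1 = n := by
  obtain ⟨p, hp, hn, -⟩ := testBit_touched h
  rw [List.getElem?_map, hx] at hp
  simp only [Option.map_some, Option.some.injEq] at hp
  rw [← hn, ← hp]

/-- Colorings of three blocks `vA`, `vE`, `vB` that fit together hit one of the patterns `g`. -/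
def copyCheck (corners vA vE vB g : List ℕ) (es : List (ℕ × ℕ)) : Bool :=
  forcePairs es fun es =>
  forceList (states es 7 64 512 vA (outSlots es corners [1, 1, 1, 1, 1])) fun A =>
  forceList (states es 7 64 512 vE (outSlots es corners [1, 2, 1, 1, 1])) fun E =>
  forceList (states es 7 64 512 vB (outSlots es corners [2, 0, 2, 1, 1])) fun B =>
  forest 14 (toLeaves E) fun tE => forest 14 (toLeaves B) fun tB =>
  force (cornerMask 0) fun m₁ => force (cornerMask 1) fun m₂ => force (Nat.lor m₁ (cornerMask 2)) fun m =>
  checkFirst width m₁ m₂ m g tE tB A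

section Graph

variable {V : Type*} {G : SimpleGraph V} {φ : ℕ → V} {es : List (ℕ × ℕ)}

theorem exists_of_good (hes : ∀ e ∈ es, G.Adj (φ e.1) (φ e.2)) {f : ℕ → ℕ} {U : List ℕ}
    {corners modes : List ℕ} {a j : ℕ} (h : Good f U (outSlots es corners modes) a)
    (hj : a.testBit j) : ∃ x, layout[j]? = some x ∧ ∃ v ∈ U, f v = x.2.1 ∧
      ((modes.getD x.1 0 = 1 ∧ G.edist (φ v) (φ (corners.getD x.1 0)) ≤ x.2.2) ∨
        (2 ≤ modes.getD x.1 0 ∧ G.edist (φ v) (φ (corners.getD x.1 0)) ≤ (x.2.1 - x.2.2 : ℕ))) := by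
  obtain ⟨p, hp, v, hv, hb, hf⟩ := h j hj
  rw [outSlots, List.getElem?_map] at hp
  cases hx : layout[j]? with
  | none => rw [hx] at hp; simp at hp
  | some x =>
    rw [hx] at hp
    simp only [Option.map_some, Option.some.injEq] at hp
    refine ⟨x, rfl, v, hv, ?_, ?_⟩
    · rw [hf, ← hp]
    · rw [← hp] at hb
      simp only at hb
      rcases hm : modes.getD x.1 0 with _ | _ | m
      · rw [hm] at hb; simp at hb
      · rw [hm] at hb
        left
        rw [SimpleGraph.edist_comm]
        exact ⟨rfl, edist_le_of_testBit_ball hes hb⟩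
      · rw [hm] at hb
        right
        rw [SimpleGraph.edist_comm]
        exact ⟨by omega, edist_le_of_testBit_ball hes hb⟩

/-- A common digit `(n, k, e)` would give a vertex of color `k` within `e` of the corner on one side
and another within `k - e` on the other, hence two within distance `k`. -/
theorem land_eq_zero_of_good (hes : ∀ e ∈ es, G.Adj (φ e.1) (φ e.2)) {f : ℕ → ℕ} {C : ℕ}
    {U U₁ U₂ : List ℕ} (hf : IsPackingOn G φ f C U) (h₁ : ∀ u ∈ U₁, u ∈ U) (h₂ : ∀ u ∈ U₂, u ∈ U)
    (hd : ∀ u ∈ U₁, u ∉ U₂) {corners modes₁ modes₂ : List ℕ} {a b n : ℕ}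
    (ha : Good f U₁ (outSlots es corners modes₁) a) (hb : Good f U₂ (outSlots es corners modes₂) b)
    (hn₁ : modes₁.getD n 0 = 1) (hn₂ : modes₂.getD n 0 = 2) : b &&& (a &&& cornerMask n) = 0 := by
  have hlay : ∀ x ∈ layout, x.2.2 ≤ x.2.1 := by decide +kernel
  apply Nat.eq_of_testBit_eq
  intro j
  rw [Nat.zero_testBit]
  by_contra hne
  simp only [Nat.testBit_and, Bool.not_eq_false, Bool.and_eq_true] at hne
  obtain ⟨hjb, hja, hjn⟩ := hne
  obtain ⟨x, hx, u, hu, hfu, hxu⟩ := exists_of_good hes ha hja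
  obtain ⟨y, hy, v, hv, hfv, hyv⟩ := exists_of_good hes hb hjb
  rw [hx, Option.some.injEq] at hy
  subst hy
  have hxn := layout_of_testBit_cornerMask hjn hx
  rw [hxn, hn₁] at hxu
  rw [hxn, hn₂] at hyv
  replace hxu := (hxu.resolve_right (by simp)).2
  replace hyv := (hyv.resolve_left (by simp)).2
  refine absurd (hf.lt_edist u (h₁ u hu) v (h₂ v hv) (fun h => hd u hu (h ▸ hv))
    (hfu.trans hfv.symm)) (not_lt.2 ?_)
  rw [SimpleGraph.edist_comm] at hyv
  refine G.edist_triangle.trans ((add_le_add hxu hyv).trans ?_)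
  rw [hfu]
  have := hlay x (List.mem_of_getElem? hx)
  norm_cast
  omega

/-- Corner 0 separates the records of A from those of B, corner 1 those of A from E, and corner 2
those of A and of E from B: mode 1 on one side, mode 2 on the other. Corner 0 also compares E with
B, for paths through A. The digits of the colored blocks must be disjoint there, which are the
compatibilities assumed by `checkFirst`. -/
theorem exists_pattern (hes : ∀ e ∈ es, G.Adj (φ e.1) (φ e.2)) {f : ℕ → ℕ} {U : List ℕ}
    (hf : IsPackingOn G φ f 7 U) {corners vA vE vB g : List ℕ}
    (hA : ∀ u ∈ vA, u ∈ U) (hE : ∀ u ∈ vE, u ∈ U) (hB : ∀ u ∈ vB, u ∈ U)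
    (hAE : ∀ u ∈ vA, u ∉ vE) (hAB : ∀ u ∈ vA, u ∉ vB) (hEB : ∀ u ∈ vE, u ∉ vB)
    (hg : ∀ y ∈ g, Nat.land y (Nat.lor (cornerMask 3) (cornerMask 4)) = y)
    (hcheck : copyCheck corners vA vE vB g es = true) :
    ∃ y ∈ g, ∀ j, y.testBit j → ∃ x, layout[j]? = some x ∧
      ∃ v ∈ U, f v = x.2.1 ∧ G.edist (φ v) (φ (corners.getD x.1 0)) ≤ x.2.2 := by
  obtain ⟨a, ha, hga⟩ := exists_mem_states (K := 64) (K' := 512) hes (hf.mono hA)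
    (outSlots es corners [1, 1, 1, 1, 1])
  obtain ⟨s, hs, hgs⟩ := exists_mem_states (K := 64) (K' := 512) hes (hf.mono hE)
    (outSlots es corners [1, 2, 1, 1, 1])
  obtain ⟨r, hr, hgr⟩ := exists_mem_states (K := 64) (K' := 512) hes (hf.mono hB)
    (outSlots es corners [2, 0, 2, 1, 1])
  unfold copyCheck at hcheck
  simp only [forcePairs_eq, forceList_eq, force_eq] at hcheck
  obtain ⟨tE, h1, hvE, hmE⟩ := exists_forest_eq 14 (states es 7 64 512 vE (outSlots es corners [1, 2, 1, 1, 1]))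
    (fun tE => forest 14 (toLeaves (states es 7 64 512 vB (outSlots es corners [2, 0, 2, 1, 1]))) fun tB =>
      checkFirst width (cornerMask 0) (cornerMask 1) (Nat.lor (cornerMask 0) (cornerMask 2)) g tE tB
        (states es 7 64 512 vA (outSlots es corners [1, 1, 1, 1, 1])))
  rw [h1] at hcheck
  obtain ⟨tB, h2, hvB, hmB⟩ := exists_forest_eq 14 (states es 7 64 512 vB (outSlots es corners [2, 0, 2, 1, 1]))
    (fun tB =>
      checkFirst width (cornerMask 0) (cornerMask 1) (Nat.lor (cornerMask 0) (cornerMask 2)) g tE tB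
        (states es 7 64 512 vA (outSlots es corners [1, 1, 1, 1, 1])))
  rw [h2] at hcheck
  have hm : Nat.lor (cornerMask 0) (cornerMask 2) < 2 ^ width :=
    Nat.or_lt_two_pow (cornerMask_lt 0) (cornerMask_lt 2)
  have hdist : ∀ p q m₁ m₂ : ℕ, p &&& (q &&& m₁) = 0 → p &&& (q &&& m₂) = 0 →
      p &&& (q &&& (m₁ ||| m₂)) = 0 := by
    intro p q m₁ m₂ h h'
    rw [Nat.and_or_distrib_left, Nat.and_or_distrib_left, h, h']; rfl
  have hdist' : ∀ p q r m : ℕ, p &&& (q &&& m) = 0 → p &&& (r &&& m) = 0 →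
      p &&& ((q ||| r) &&& m) = 0 := by
    intro p q r m h h'
    rw [Nat.and_or_distrib_right, Nat.and_or_distrib_left, h, h']; rfl
  have ar0 := land_eq_zero_of_good (n := 0) hes hf hA hB hAB hga hgr rfl rfl
  obtain ⟨y, hy, hsub⟩ := exists_of_checkFirst hm hvE hvB hcheck ha (hmE s hs) (hmB r hr)
    (land_eq_zero_of_good hes hf hA hE hAE hga hgs rfl rfl) ar0
    (hdist' _ _ _ _
      (hdist _ _ _ _ ar0 (land_eq_zero_of_good hes hf hA hB hAB hga hgr rfl rfl))
      (hdist _ _ _ _ (land_eq_zero_of_good hes hf hE hB hEB hgs hgr rfl rfl)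
        (land_eq_zero_of_good hes hf hE hB hEB hgs hgr rfl rfl)))
  refine ⟨y, hy, fun j hj => ?_⟩
  -- Pattern digits belong to the outward corners, where every block has mode 1; hence it does not
  -- matter which block supplied a digit.
  have hcor : ∀ x, layout[j]? = some x → x.1 = 3 ∨ x.1 = 4 := by
    intro x hx
    have h34 : (cornerMask 3 ||| cornerMask 4).testBit j := by
      have : y &&& (cornerMask 3 ||| cornerMask 4) = y := hg y hy
      rw [← this, Nat.testBit_and, Bool.and_eq_true] at hj
      exact hj.2
    rw [Nat.testBit_or, Bool.or_eq_true] at h34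
    exact h34.imp (fun h => layout_of_testBit_cornerMask h hx) fun h => layout_of_testBit_cornerMask h hx
  have hj' := hsub j hj
  rw [Nat.testBit_or, Nat.testBit_or, Bool.or_eq_true, Bool.or_eq_true] at hj'
  have conclude : ∀ {vs modes : List ℕ} {b : ℕ}, (∀ u ∈ vs, u ∈ U) →
      Good f vs (outSlots es corners modes) b → b.testBit j → modes.getD 3 0 = 1 → modes.getD 4 0 = 1 →
      ∃ x, layout[j]? = some x ∧
        ∃ v ∈ U, f v = x.2.1 ∧ G.edist (φ v) (φ (corners.getD x.1 0)) ≤ x.2.2 := by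
    intro vs modes b hvs hb hbj h3 h4
    obtain ⟨x, hx, v, hv, hfv, h⟩ := exists_of_good hes hb hbj
    refine ⟨x, hx, v, hvs v hv, hfv, ?_⟩
    have hmode : modes.getD x.1 0 = 1 := by
      rcases hcor x hx with h | h <;> rw [h] <;> assumption
    rw [hmode] at h
    exact (h.resolve_right (by simp)).2
  rcases hj' with (h | h) | h
  · exact conclude hA hga h rfl rfl
  · exact conclude hE hgs h rfl rfl
  · exact conclude hB hgr h rfl rfl

end Graph

/-- The edges of the generalized Sierpiński graph of the paw of dimension `n`, a word being
given by the number with its letters as digits to the base `4`. -/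
def edges : ℕ → List (ℕ × ℕ)
  | 0 => []
  | n + 1 => ([0, 1, 2, 3].flatMap fun a => (edges n).map fun e => (4 ^ n * a + e.1, 4 ^ n * a + e.2)) ++
      [(0, 1), (0, 2), (1, 2), (2, 3)].map fun e =>
        (4 ^ n * e.1 + (4 ^ n - 1) / 3 * e.2, 4 ^ n * e.2 + (4 ^ n - 1) / 3 * e.1)

end Sweep

/-! ### Adjacency in the graph and restriction of colorings -/

theorem pawGraph_adj_iff (a b : Fin 4) : pawGraph.Adj a b ↔
    (a, b) ∈ [((0 : Fin 4), (1 : Fin 4)), (1, 0), (0, 2), (2, 0), (1, 2), (2, 1), (2, 3), (3, 2)] := by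
  rw [pawGraph, SimpleGraph.fromEdgeSet_adj]
  simp only [Set.mem_insert_iff, Set.mem_singleton_iff]
  revert a b
  decide

instance : DecidableRel pawGraph.Adj := fun a b => decidable_of_iff _ (pawGraph_adj_iff a b).symm

instance {V : Type*} [Fintype V] [DecidableEq V] (G : SimpleGraph V) [DecidableRel G.Adj] (n : ℕ) :
    DecidableRel (genSierpinskiGraph G n).Adj := fun u v =>
  inferInstanceAs (Decidable (∃ i : Fin n, (∀ j, j < i → u j = v j) ∧
    (u i ≠ v i ∧ G.Adj (u i) (v i)) ∧ ∀ j, i < j → u j = v i ∧ v j = u i))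

section General

variable {V : Type*} {G : SimpleGraph V}

/-- The cases are the first difference lying in the suffix (an edge inside a block) or in the prefix
(an edge joining corners of two blocks). -/
theorem genSierpinskiGraph_adj_append {m n : ℕ} (p q : Fin m → V) (x y : Fin n → V) :
    (genSierpinskiGraph G (m + n)).Adj (Fin.append p x) (Fin.append q y) ↔
      (p = q ∧ (genSierpinskiGraph G n).Adj x y) ∨
        ∃ i : Fin m, ((∀ j, j < i → p j = q j) ∧ (p i ≠ q i ∧ G.Adj (p i) (q i)) ∧
          ∀ j, i < j → p j = q i ∧ q j = p i) ∧ (∀ j, x j = q i) ∧ ∀ j, y j = p i := by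
  constructor
  · rintro ⟨i, h1, h2, h3⟩
    induction i using Fin.addCases with
    | left i =>
      right
      refine ⟨i, ⟨fun j hj => ?_, by simpa using h2, fun j hj => ?_⟩, fun j => ?_, fun j => ?_⟩
      · simpa using h1 (Fin.castAdd n j) hj
      · simpa using h3 (Fin.castAdd n j) hj
      · simpa using (h3 (Fin.natAdd m j) (by rw [Fin.lt_def]; simp; omega)).1
      · simpa using (h3 (Fin.natAdd m j) (by rw [Fin.lt_def]; simp; omega)).2
    | right i =>
      left
      refine ⟨funext fun j => ?_, i, fun j hj => ?_, by simpa using h2, fun j hj => ?_⟩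
      · simpa using h1 (Fin.castAdd n j) (by rw [Fin.lt_def]; simp; omega)
      · simpa using h1 (Fin.natAdd m j) (by simpa using hj)
      · simpa using h3 (Fin.natAdd m j) (by simpa using hj)
  · rintro (⟨rfl, i, h1, h2, h3⟩ | ⟨i, ⟨h1, h2, h3⟩, hx, hy⟩)
    · refine ⟨Fin.natAdd m i, fun j hj => ?_, by simpa using h2, fun j hj => ?_⟩
      · induction j using Fin.addCases with
        | left j => simp
        | right j => simpa using h1 j (by simpa using hj)
      · induction j using Fin.addCases with
        | left j => rw [Fin.lt_def] at hj; simp at hj; omega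
        | right j => simpa using h3 j (by simpa using hj)
    · refine ⟨Fin.castAdd n i, fun j hj => ?_, by simpa using h2, fun j hj => ?_⟩
      · induction j using Fin.addCases with
        | left j => simpa using h1 j hj
        | right j => rw [Fin.lt_def] at hj; simp at hj; omega
      · induction j using Fin.addCases with
        | left j => simpa using h3 j hj
        | right j => simp [hx, hy]

theorem le_packingChromaticNumber {C : ℕ} (h : ∀ c f, IsPackingColoring G c f → C ≤ c) :
    (C : ℕ∞) ≤ packingChromaticNumber G :=
  le_iInf₂ fun c ⟨f, hf⟩ => by exact_mod_cast h c f hf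

theorem packingChromaticNumber_le {C : ℕ} {f : V → ℕ} (h : IsPackingColoring G C f) :
    packingChromaticNumber G ≤ C :=
  iInf₂_le C ⟨f, h⟩

theorem IsPackingColoring.isPackingOn {f : V → ℕ} {c C : ℕ} (h : IsPackingColoring G c f)
    (hc : c ≤ C) {φ : ℕ → V} {U : List ℕ} (hφ : ∀ u ∈ U, ∀ v ∈ U, φ u = φ v → u = v) :
    Sweep.IsPackingOn G φ (fun u => f (φ u)) C U := by
  have hmem : ∀ v, f v ∈ Set.Icc 1 c := fun v => h.1 ▸ Set.mem_range_self v
  exact ⟨fun u _ => (hmem _).1, fun u _ => (hmem _).2.trans hc,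
    fun u hu v hv huv hf => h.2 _ _ (fun h' => huv (hφ u hu v hv h')) hf⟩

end General

namespace Sweep

/-- The word of length `n` whose letters are the digits of `c` to the base `4`. -/
def word (n c : ℕ) : Fin n → Fin 4 := fun i => Fin.ofNat 4 (c / 4 ^ (n - 1 - i))

/-- Interchanges the letters `0` and `1`. -/
def mirror (n : ℕ) (w : Fin n → Fin 4) : Fin n → Fin 4 := fun i => Equiv.swap 0 1 (w i)

theorem word_three_injective : ∀ u ∈ List.range 64, ∀ v ∈ List.range 64,
    word 3 u = word 3 v → u = v := by decide +kernel

theorem adj_word_three : ∀ e ∈ edges 3,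
    (genSierpinskiGraph pawGraph 3).Adj (word 3 e.1) (word 3 e.2) := by decide +kernel

theorem adj_mirror_word_three : ∀ e ∈ edges 3,
    (genSierpinskiGraph pawGraph 3).Adj (mirror 3 (word 3 e.1)) (mirror 3 (word 3 e.2)) := by
  decide +kernel

/-! ### Conflicts between neighboring copies -/

/-- The positions `(i, j)` in the layout of `(n, k, e)` and `(n', k, e')` with `e + e' = k - 1`. -/
def conflicts (n n' : ℕ) : List (ℕ × ℕ) :=
  (List.range width).flatMap fun i => (List.range width).filterMap fun j =>
    if (layout[i]?.any fun x => layout[j]?.any fun y =>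
      x.1 = n ∧ y.1 = n' ∧ x.2.1 = y.2.1 ∧ x.2.2 + y.2.2 + 1 = x.2.1) then some (i, j) else none

def conflict (ps : List (ℕ × ℕ)) (x y : ℕ) : Bool := ps.any fun p => x.testBit p.1 && y.testBit p.2

/-- Through the linking edge the two vertices of color `k` are at distance at most `e + 1 + e' = k`.
-/
theorem not_conflict {V : Type*} {G : SimpleGraph V} {f : V → ℕ}
    (hf : ∀ u v, u ≠ v → f u = f v → (f u : ℕ∞) < G.edist u v) {φ ψ : ℕ → V}
    (hne : ∀ u v, φ u ≠ ψ v) {c c' : List ℕ} {n n' : ℕ}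
    (hadj : G.Adj (φ (c.getD n 0)) (ψ (c'.getD n' 0))) {x y : ℕ}
    (hx : ∀ j, x.testBit j → ∃ t, layout[j]? = some t ∧
      ∃ v ∈ List.range 64, f (φ v) = t.2.1 ∧ G.edist (φ v) (φ (c.getD t.1 0)) ≤ t.2.2)
    (hy : ∀ j, y.testBit j → ∃ t, layout[j]? = some t ∧
      ∃ v ∈ List.range 64, f (ψ v) = t.2.1 ∧ G.edist (ψ v) (ψ (c'.getD t.1 0)) ≤ t.2.2) :
    conflict (conflicts n n') x y = false := by
  rw [← Bool.not_eq_true]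
  intro h
  obtain ⟨⟨i, j⟩, hp, h⟩ := List.any_eq_true.1 h
  rw [Bool.and_eq_true] at h
  obtain ⟨s, hs, u, -, hu, hus⟩ := hx i h.1
  obtain ⟨t, ht, v, -, hv, hvt⟩ := hy j h.2
  simp only [conflicts, List.mem_flatMap, List.mem_filterMap] at hp
  obtain ⟨i', -, j', -, hp⟩ := hp
  split_ifs at hp with hc
  simp only [Option.some.injEq, Prod.mk.injEq] at hp
  obtain ⟨rfl, rfl⟩ := hp
  rw [hs, Option.any_some, ht, Option.any_some, decide_eq_true_eq] at hc
  obtain ⟨h1, h2, h3, h4⟩ := hc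
  rw [h1] at hus
  rw [h2, SimpleGraph.edist_comm] at hvt
  refine absurd (hf _ _ (hne u v) (by rw [hu, hv, h3])) (not_lt.2 ?_)
  refine (G.edist_triangle.trans (add_le_add (G.edist_triangle.trans
    (add_le_add hus (SimpleGraph.edist_eq_one_iff_adj.2 hadj).le)) hvt)).trans ?_
  rw [hu]
  norm_cast
  omega

/-- Three patterns around the triangle of the copies always conflict. -/
def ringCheck (g g' : List ℕ) : Bool :=
  let p := conflicts 3 3
  let q := conflicts 4 4
  let r := conflicts 4 3
  g'.all fun z => (g.filter fun x => !conflict q x z).all fun x =>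
    (g.filter fun y => !conflict r y z).all fun y => conflict p x y

/-- A set of patterns hit by the colorings of the copies `0` and, mirrored, `1`. -/
def outerPatterns : List ℕ :=
  [5130024429494710163620078030848, 5130024429494710163620086415360,
   5130643408959085819496813826048, 5130643408959085819496822210560,
   10201864789334685727799543595136, 10201864789334685727799551983616,
   10201864789335838649304150441984, 10201864789336379081360366637056,
   10201864789336379081360375021568, 15233471474547744479799947558912,
   15233471483991954887213831946432, 15233471483991954957582576124096,
   15233471483992531277631750930624, 15253278807962474055729261051968,
   15253278807962474055729265246208, 15253278826851976016003782934528,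
   15253278826853128937508385587200, 15271847606320299856194380496896,
   15271848210784938975500204769280, 15272466585784693526469625774080,
   15272466585784693526469629968384, 15272467190247603333784208932864,
   15273085546359567222070770139136, 15273085555804300187810056372224,
   15273085565249069182348509053056, 15273085565249086985641859743936,
   15273085565249087196744871051264, 15273085858036908013040676376576,
   15273085858036908013040684761088, 15273085867480541889299153420480,
   15273085867480542100402164727808, 15273086150824206200639106056192,
   15273086160267209995124647919616, 15273086160268939236747144855552]

/-- The words `011`, `022`, `211`, `111`, `222`. The first two lead from block A (first letter 0) to
B (1) and E (2), the third from E to B; the last two face the copies 1 and 2. -/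
def outerCorners : List ℕ := [5, 10, 37, 21, 42]

def outerA : List ℕ := [2, 3, 7, 6, 1, 0, 5, 4, 8, 9, 10, 11]

def outerE : List ℕ := [35, 34, 32, 33, 43, 42, 40, 41, 38, 36, 37, 39]

def outerB : List ℕ := [23, 22, 18, 19, 20, 21, 16, 17, 25, 24, 26, 27]

set_option maxRecDepth 100000 in
set_option maxHeartbeats 0 in
theorem copyCheck_outer :
    copyCheck outerCorners outerA outerE outerB outerPatterns (edges 3) = true := by
  decide +kernel

/-- A set of patterns hit by the colorings of the copy `2`. -/
def innerPatterns : List ℕ :=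
  [5110836066097353463480732090368, 5130024429494710163620078026752,
   10162250103614643751688192655360, 10200626830407627769606895042560,
   15232852504527561357672853798912, 15232852504527561357672857993216,
   15233471474547168019013284397056, 15233471483991954957582576124096,
   15233471483992513474304040501376, 15252040867923188675453283991552,
   15252040867923188675453288185856, 15253278826851975875269511610560,
   15253278826853092908712440365120, 15271848210783209663508959461376,
   15272467190247603333784208932864, 15273085565249069182348509053056,
   15273085565249086985641859743936, 15273085858036908013040676372480,
   15273085867480506071606219505728, 15273085867480541889299153420480,
   15273086150822477029385357492224, 15273086150824224355776186023936,
   15273086160267209995124639531008, 15273086160268939236747144855552,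
   15273086169713690146517270134784, 15273086169713708160916853358592,
   15273086169713726245681959534592, 15273086169713726316050703712256]

/-- The words `211`, `200`, `011`, `111`, `000`. Now A has first letter 2, E has 0 and B has 1; the
last two words face the copies 1 and 0. -/
def innerCorners : List ℕ := [37, 32, 5, 21, 0]

def innerA : List ℕ := [35, 34, 32, 43, 42, 40, 41, 38, 33, 36, 37, 39]

def innerE : List ℕ := [3, 2, 6, 7, 1, 0, 5, 4, 8, 9, 10, 11]

def innerB : List ℕ := [23, 22, 18, 19, 20, 21, 16, 17, 25, 24, 26, 27]

set_option maxRecDepth 100000 in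
set_option maxHeartbeats 0 in
theorem copyCheck_inner :
    copyCheck innerCorners innerA innerE innerB innerPatterns (edges 3) = true := by
  decide +kernel

theorem ringCheck_patterns : ringCheck outerPatterns innerPatterns = true := by
  decide +kernel

/-! ### Lower bounds -/

theorem no_packing_of_states_eq_nil {V : Type*} {G : SimpleGraph V} {φ : ℕ → V}
    {es : List (ℕ × ℕ)} (hes : ∀ e ∈ es, G.Adj (φ e.1) (φ e.2)) {C : ℕ} {vs : List ℕ}
    (hφ : ∀ u ∈ vs, ∀ v ∈ vs, φ u = φ v → u = v)
    (hlen : Nat.beq (len (forcePairs es fun es => states es C 64 64 vs [])) 0 = true) :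
    ((C + 1 : ℕ) : ℕ∞) ≤ packingChromaticNumber G := by
  refine le_packingChromaticNumber fun c f hf => ?_
  by_contra hc
  obtain ⟨n, hn, -⟩ := exists_mem_states (K := 64) (K' := 64) hes
    (hf.isPackingOn (by omega : c ≤ C) hφ) []
  rw [forcePairs_eq, len_eq] at hlen
  rw [List.length_eq_zero_iff.1 (Nat.eq_of_beq_eq_true hlen)] at hn
  simp at hn

theorem three_le : (3 : ℕ∞) ≤ packingChromaticNumber (genSierpinskiGraph pawGraph 1) :=
  no_packing_of_states_eq_nil (φ := word 1) (es := edges 1) (C := 2) (vs := [0, 1, 2])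
    (by decide +kernel) (by decide +kernel) (by decide +kernel)

theorem five_le : (5 : ℕ∞) ≤ packingChromaticNumber (genSierpinskiGraph pawGraph 2) :=
  no_packing_of_states_eq_nil (φ := word 2) (es := edges 2) (C := 4) (vs := List.range 12)
    (by decide +kernel) (by decide +kernel) (by decide +kernel)

set_option maxRecDepth 100000 in
set_option maxHeartbeats 0 in
theorem seven_le : (7 : ℕ∞) ≤ packingChromaticNumber (genSierpinskiGraph pawGraph 3) :=
  no_packing_of_states_eq_nil (φ := word 3) (es := edges 3) (C := 6)
    -- The words whose first two letters avoid 3 already suffice.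
    (vs := [0, 1, 2, 3, 4, 5, 6, 7, 8, 9, 10, 11, 16, 17, 18, 19, 20, 21, 22, 23, 24, 25, 26, 27,
      32, 33, 34, 35, 36, 37, 38, 39, 40, 41, 42, 43])
    (by decide +kernel) (by decide +kernel) (by decide +kernel)

/-- The word `0 ⋯ 0 a`. -/
def copyPrefix (m : ℕ) (a : Fin 4) : Fin (m + 1) → Fin 4 := Fin.snoc (fun _ => 0) a

theorem copyPrefix_last (m : ℕ) (a : Fin 4) : copyPrefix m a (Fin.last m) = a := by
  simp [copyPrefix]

theorem append_injective {m n : ℕ} {p q : Fin m → Fin 4} {x y : Fin n → Fin 4}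
    (h : Fin.append p x = Fin.append q y) : p = q ∧ x = y := by
  constructor
  · funext i; simpa using congrFun h (Fin.castAdd n i)
  · funext i; simpa using congrFun h (Fin.natAdd m i)

theorem adj_corner (m : ℕ) {a b : Fin 4} (hab : pawGraph.Adj a b) {x y : Fin 3 → Fin 4}
    (hx : ∀ j, x j = b) (hy : ∀ j, y j = a) : (genSierpinskiGraph pawGraph (m + 1 + 3)).Adj
      (Fin.append (copyPrefix m a) x) (Fin.append (copyPrefix m b) y) := by
  rw [genSierpinskiGraph_adj_append]
  refine Or.inr ⟨Fin.last m, ⟨fun j hj => ?_, ?_, fun j hj => absurd hj (not_lt.2 (Fin.le_last j))⟩,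
    ?_, ?_⟩
  · obtain ⟨k, rfl⟩ := Fin.exists_castSucc_eq.2 hj.ne
    simp [copyPrefix]
  · rw [copyPrefix_last, copyPrefix_last]
    exact ⟨hab.ne, hab⟩
  · rw [copyPrefix_last]; exact hx
  · rw [copyPrefix_last]; exact hy

theorem ringCheck_spec {g g' : List ℕ} (h : ringCheck g g' = true) {x y z : ℕ} (hx : x ∈ g)
    (hy : y ∈ g) (hz : z ∈ g') : conflict (conflicts 4 4) x z = true ∨
      conflict (conflicts 4 3) y z = true ∨ conflict (conflicts 3 3) x y = true := by
  simp only [ringCheck, List.all_eq_true, List.mem_filter, Bool.not_eq_true', and_imp] at h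
  by_contra hne
  push Not at hne
  simp only [ne_eq, Bool.not_eq_true] at hne
  rw [h z hz x hx hne.1 y hy hne.2.1] at hne
  simp at hne

/-- The three copies get patterns `x`, `y`, `z`, and each conflict allowed by `ringCheck_spec`
contradicts `not_conflict` at the edge between the two copies concerned. -/
theorem eight_le (m : ℕ) :
    (8 : ℕ∞) ≤ packingChromaticNumber (genSierpinskiGraph pawGraph (m + 1 + 3)) := by
  refine le_packingChromaticNumber (C := 8) fun c f hf => ?_
  by_contra hc
  have hinj : ∀ a, ∀ u ∈ List.range 64, ∀ v ∈ List.range 64,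
      Fin.append (copyPrefix m a) (word 3 u) = Fin.append (copyPrefix m a) (word 3 v) → u = v :=
    fun a u hu v hv h => word_three_injective u hu v hv (append_injective h).2
  have hinj' : ∀ a, ∀ u ∈ List.range 64, ∀ v ∈ List.range 64,
      Fin.append (copyPrefix m a) (mirror 3 (word 3 u)) =
        Fin.append (copyPrefix m a) (mirror 3 (word 3 v)) → u = v :=
    fun a u hu v hv h => word_three_injective u hu v hv (funext fun i =>
      (Equiv.swap (0 : Fin 4) 1).injective (congrFun (append_injective h).2 i))
  have hadj : ∀ a, ∀ e ∈ edges 3, (genSierpinskiGraph pawGraph (m + 1 + 3)).Adj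
      (Fin.append (copyPrefix m a) (word 3 e.1)) (Fin.append (copyPrefix m a) (word 3 e.2)) :=
    fun a e he => (genSierpinskiGraph_adj_append _ _ _ _).2 (Or.inl ⟨rfl, adj_word_three e he⟩)
  have hadj' : ∀ a, ∀ e ∈ edges 3, (genSierpinskiGraph pawGraph (m + 1 + 3)).Adj
      (Fin.append (copyPrefix m a) (mirror 3 (word 3 e.1)))
      (Fin.append (copyPrefix m a) (mirror 3 (word 3 e.2))) :=
    fun a e he => (genSierpinskiGraph_adj_append _ _ _ _).2
      (Or.inl ⟨rfl, adj_mirror_word_three e he⟩)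
  have hne : ∀ a b, a ≠ b → ∀ x y : Fin 3 → Fin 4,
      Fin.append (copyPrefix m a) x ≠ Fin.append (copyPrefix m b) y := fun a b hab x y h =>
    hab (by simpa [copyPrefix_last] using congrFun (append_injective h).1 (Fin.last m))
  have hc7 : c ≤ 7 := by omega
  obtain ⟨x, hx, hx'⟩ := exists_pattern (hadj 0) (hf.isPackingOn hc7 (hinj 0))
    (by decide) (by decide) (by decide) (by decide) (by decide) (by decide) (by decide +kernel)
    copyCheck_outer
  -- Interchanging 0 and 1 turns `111` into `000`, the corner of copy 1 facing copy 0, and fixes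
  -- `222`, so the patterns of copy 0 serve here too.
  obtain ⟨y, hy, hy'⟩ := exists_pattern (hadj' 1) (hf.isPackingOn hc7 (hinj' 1))
    (by decide) (by decide) (by decide) (by decide) (by decide) (by decide) (by decide +kernel)
    copyCheck_outer
  obtain ⟨z, hz, hz'⟩ := exists_pattern (hadj 2) (hf.isPackingOn hc7 (hinj 2))
    (by decide) (by decide) (by decide) (by decide) (by decide) (by decide) (by decide +kernel)
    copyCheck_inner
  rcases ringCheck_spec ringCheck_patterns hx hy hz with h | h | h
  · rw [not_conflict hf.2 (fun u v => hne 0 2 (by decide) _ _)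
      (adj_corner m (by decide) (by decide) (by decide)) hx' hz'] at h
    simp at h
  · rw [not_conflict hf.2 (fun u v => hne 1 2 (by decide) _ _)
      (adj_corner m (by decide) (by decide) (by decide)) hy' hz'] at h
    simp at h
  · rw [not_conflict hf.2 (fun u v => hne 0 1 (by decide) _ _)
      (adj_corner m (by decide) (by decide) (by decide)) hx' hy'] at h
    simp at h

/-! ### Upper bounds from explicit tables -/

/-- The number with the letters of `x` as digits to the base `4`. -/
def code {n : ℕ} (x : Fin n → Fin 4) : ℕ := ∑ i, (x i : ℕ) * 4 ^ (n - 1 - i : ℕ)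

/-- All edges are listed in `edges n`. -/
def Complete (n : ℕ) : Prop := ∀ x y : Fin n → Fin 4, (genSierpinskiGraph pawGraph n).Adj x y →
  (code x, code y) ∈ edges n ∨ (code y, code x) ∈ edges n

instance (n : ℕ) : Decidable (Complete n) := by unfold Complete; infer_instance

/-- A property of vertices at bounded distance from `u` that is passed on along edges. -/
theorem of_edist_le {V : Type*} {G : SimpleGraph V} {u : V} (R : ℕ → V → Prop) (h0 : ∀ d, R d u)
    (hs : ∀ d x y, R d x → G.Adj x y → R (d + 1) y) {d : ℕ} {x : V} (h : G.edist u x ≤ d) :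
    R d x := by
  -- The walk is taken backwards, from `x` to `u`, so that its first edge is the last step towards
  -- `x`.
  have key : ∀ {x u' : V} (p : G.Walk x u'), u' = u → ∀ d, p.length ≤ d → R d x := by
    intro x u' p
    induction p with
    | nil => rintro rfl d _; exact h0 d
    | cons hadj p ih =>
      intro hu d hd
      obtain ⟨e, rfl⟩ : ∃ e, d = e + 1 :=
        ⟨d - 1, by rw [SimpleGraph.Walk.length_cons] at hd; omega⟩
      rw [SimpleGraph.Walk.length_cons] at hd
      exact hs e _ _ (ih hu e (by omega)) hadj.symm
  have hne : G.edist u x ≠ ⊤ := fun ht => by rw [ht] at h; simp at h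
  obtain ⟨p, hp⟩ := SimpleGraph.exists_walk_of_edist_ne_top hne
  exact key p.reverse rfl d (by rw [SimpleGraph.Walk.length_reverse]; rw [← hp] at h; exact_mod_cast h)

/-- The converse of `edist_le_of_testBit_ball`: here the list must contain all edges. -/
theorem testBit_ball_of_edist_le {n : ℕ} (hn : Complete n) {x y : Fin n → Fin 4} {d : ℕ}
    (h : (genSierpinskiGraph pawGraph n).edist x y ≤ d) :
    (ball (edges n) (code x) d).testBit (code y) :=
  of_edist_le (fun d y => (ball (edges n) (code x) d).testBit (code y) = true)
    (fun d => testBit_ball_self _ _ d)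
    (fun d y z hy hyz => by
      rw [ball_succ, testBit_next]
      exact Or.inr ⟨_, hy, hn y z hyz⟩) h

/-- The `u`-th decimal digit of `T`. -/
def digit (T u : ℕ) : ℕ := Nat.mod (Nat.div T (Nat.pow 10 u)) 10

/-- The digits of `T` color the words of length `n` with the colors `1, …, C`. -/
def PackingTable (n C T : ℕ) : Bool :=
  forcePairs (edges n) fun es => forceList (List.range (4 ^ n)) fun U =>
  (List.range C).all (fun k => U.any fun u => Nat.beq (digit T u) (k + 1)) &&
  U.all fun u => (decide (1 ≤ digit T u ∧ digit T u ≤ C)) && force (ball es u (digit T u)) fun m =>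
    U.all fun v => Nat.beq u v || !Nat.beq (digit T u) (digit T v) || !m.testBit v

/-- Different words have different codes, below `4 ^ n`. -/
def Coded (n : ℕ) : Prop := (∀ x : Fin n → Fin 4, code x < 4 ^ n ∧ word n (code x) = x) ∧
  ∀ u < 4 ^ n, code (word n u) = u

instance (n : ℕ) : Decidable (Coded n) := by unfold Coded; infer_instance

theorem PackingTable.spec {n C T : ℕ} (h : PackingTable n C T = true) :
    (∀ k, 1 ≤ k → k ≤ C → ∃ u < 4 ^ n, digit T u = k) ∧ (∀ u < 4 ^ n, 1 ≤ digit T u ∧ digit T u ≤ C) ∧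
    ∀ u < 4 ^ n, ∀ v < 4 ^ n, u ≠ v → digit T u = digit T v →
      ¬ (ball (edges n) u (digit T u)).testBit v := by
  simp only [PackingTable, forcePairs_eq, forceList_eq, force_eq, Bool.and_eq_true, List.all_eq_true,
    List.any_eq_true, List.mem_range, decide_eq_true_eq, Nat.beq_eq, Bool.or_eq_true,
    Bool.not_eq_true'] at h
  obtain ⟨h1, h2⟩ := h
  refine ⟨fun k hk hkC => ?_, fun u hu => (h2 u hu).1, fun u hu v hv huv hd => ?_⟩
  · obtain ⟨u, hu, h⟩ := h1 (k - 1) (by omega)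
    exact ⟨u, hu, by omega⟩
  · rcases (h2 u hu).2 v hv with (h | h) | h
    · exact absurd h huv
    · rw [hd] at h
      have := Nat.beq_refl (digit T v)
      simp_all
    · simp [h]

theorem packingChromaticNumber_le_of_table {n C T : ℕ} (hn : Complete n) (hc : Coded n)
    (h : PackingTable n C T = true) :
    packingChromaticNumber (genSierpinskiGraph pawGraph n) ≤ C := by
  obtain ⟨h1, h2, h3⟩ := PackingTable.spec h
  refine packingChromaticNumber_le (f := fun x => digit T (code x)) ⟨?_, fun x y hxy hf => ?_⟩
  · ext k
    constructor
    · rintro ⟨x, rfl⟩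
      exact h2 _ (hc.1 x).1
    · rintro ⟨hk, hkC⟩
      obtain ⟨u, hu, rfl⟩ := h1 k hk hkC
      exact ⟨word n u, by simp only [hc.2 u hu]⟩
  · by_contra hd
    refine h3 _ (hc.1 x).1 _ (hc.1 y).1 (fun h => hxy ?_) hf
      (testBit_ball_of_edist_le hn (not_lt.1 hd))
    rw [← (hc.1 x).2, h, (hc.1 y).2]

theorem complete_one : Complete 1 := by decide +kernel
theorem complete_two : Complete 2 := by decide +kernel
theorem complete_three : Complete 3 := by decide +kernel
theorem coded_one : Coded 1 := by decide +kernel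
theorem coded_two : Coded 2 := by decide +kernel
theorem coded_three : Coded 3 := by decide +kernel

theorem le_three : packingChromaticNumber (genSierpinskiGraph pawGraph 1) ≤ 3 :=
  packingChromaticNumber_le_of_table complete_one coded_one (T := 1213) (by decide +kernel)

theorem le_five : packingChromaticNumber (genSierpinskiGraph pawGraph 2) ≤ 5 :=
  packingChromaticNumber_le_of_table complete_two coded_two (T := 5321121413213152)
    (by decide +kernel)

theorem le_seven : packingChromaticNumber (genSierpinskiGraph pawGraph 3) ≤ 7 :=
  packingChromaticNumber_le_of_table complete_three coded_three
    (T := 1342121513211462174312151412136112411312151217411357121413213152) (by decide +kernel)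

/-! ### Eight colors suffice in every dimension from three on -/

/-- For each pair of letters a table coloring the words of length three. -/
def tables : List ℕ :=
  [1412152116313721124113121812164114121512131217611312121513213142,
   1412138116211241151217121312314612311521131614211241312518313124,
   1231142131561713125131861214123112311513121412161231171213121451,
   1312124115611781131215141231127112811641312512131251131214121681,
   1412152116313721124113121812164114121512131217611312121513213142,
   1412138116211241151217121312314612311521131614211241312518313124,
   1312124116711831131212413128131214121531121412161312171512311241,
   1312124115611781131215141231127112811641312512131251131214121681,
   1412132115611781124113121812164113121512131231671312121513213142,
   8651121413213152135117121312314613211521131614121241312518313124,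
   1312124115611781131212161415132113121218131221461312171213211451,
   1312124115611781131215141231127112811641312512131251131214121681,
   1412152116313721124113121812164114121512131217611312121513213142,
   1412138116211241151217121312314612311521131614211241312518313124,
   1312124115611781131212161415132113121218131221461312171213211451,
   1312124115611781131215141231127112811641312512131251131214121681]

/-- The last two different letters of a word are tracked by `step`: from `(i, j)` the letter `k`
leads to `(j, k)`, unless `k = j`. -/
def step (s : Fin 4 × Fin 4) (k : Fin 4) : Fin 4 × Fin 4 := if k = s.2 then s else (s.2, k)

/-- The index is at most 15, so the default is never used. -/
def table (s : Fin 4 × Fin 4) : ℕ := tables.getD (4 * s.1 + s.2) 0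

/-- The start `(0, 1)` has different letters and `step` preserves this. The diagonal tables are
therefore never reached; they let the checks range over all pairs. -/
def state : (m : ℕ) → (Fin m → Fin 4) → Fin 4 × Fin 4
  | 0, _ => (0, 1)
  | m + 1, p => step (state m (Fin.init p)) (p (Fin.last m))

/-- `p` and `q` are adjacent, with letters `a` and `b` at the first difference. -/
def Linked (a b : Fin 4) {m : ℕ} (p q : Fin m → Fin 4) : Prop :=
  ∃ i : Fin m, ((∀ j, j < i → p j = q j) ∧ (p i ≠ q i ∧ pawGraph.Adj (p i) (q i)) ∧
    ∀ j, i < j → p j = q i ∧ q j = p i) ∧ p i = a ∧ q i = b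

theorem Linked.adj {a b : Fin 4} {m : ℕ} {p q : Fin m → Fin 4} (h : Linked a b p q) :
    pawGraph.Adj a b := by
  obtain ⟨i, ⟨-, h2, -⟩, rfl, rfl⟩ := h
  exact h2.2

/-- Both linking positions are the last place where `q` has a letter other than `a`. Hence a corner
of a block leads to at most one other block. -/
theorem Linked.eq_of_linked {a b c : Fin 4} {m : ℕ} {p q r : Fin m → Fin 4} (h : Linked a b p q)
    (h' : Linked c a q r) : r = p ∧ c = b := by
  obtain ⟨i, ⟨h1, h2, h3⟩, ha, hb⟩ := h
  obtain ⟨i', ⟨h1', h2', h3'⟩, hc', ha'⟩ := h'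
  have hii : i = i' := by
    rcases lt_trichotomy i i' with hlt | heq | hlt
    · refine absurd ?_ h2'.1
      rw [(h3 i' hlt).2, ha, ha']
    · exact heq
    · refine absurd ?_ h2.1
      rw [(h3' i hlt).1, ha, ha']
  subst hii
  refine ⟨funext fun j => ?_, hc'.symm.trans hb⟩
  rcases lt_trichotomy j i with hlt | heq | hlt
  · rw [h1 j hlt, h1' j hlt]
  · rw [heq, ha, ha']
  · rw [(h3' j hlt).2, (h3 j hlt).1]

/-- If the first difference is the last letter, both states arise from a common one. Otherwise `p`
ends in `a b ⋯ b` and `q` in `b a ⋯ a`, and these tails determine the states. -/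
theorem Linked.state {a b : Fin 4} {m : ℕ} {p q : Fin m → Fin 4} (h : Linked a b p q) :
    (∃ s, state m p = step s a ∧ state m q = step s b) ∨ (state m p = (a, b) ∧ state m q = (b, a)) := by
  induction m with
  | zero => obtain ⟨i, -⟩ := h; exact i.elim0
  | succ m ih =>
    have hab := h.adj.ne
    obtain ⟨i, ⟨h1, h2, h3⟩, ha, hb⟩ := h
    induction i using Fin.lastCases with
    | last =>
      left
      refine ⟨Sweep.state m (Fin.init p), by rw [Sweep.state, ha], ?_⟩
      have : Fin.init p = Fin.init q := funext fun j => h1 _ (Fin.castSucc_lt_last j)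
      rw [Sweep.state, this, hb]
    | cast i =>
      right
      have hl := h3 (Fin.last m) (Fin.castSucc_lt_last i)
      -- Whatever came before, the letters `a`, `b` lead to `(a, b)`, and repeating `b` changes
      -- nothing.
      have key : ∀ a b : Fin 4, a ≠ b → (∀ s, step (step s a) b = (a, b)) ∧
          step (a, b) b = (a, b) := by decide +kernel
      rw [Sweep.state, Sweep.state, hl.1, hl.2, ha, hb]
      have ih' := ih (p := Fin.init p) (q := Fin.init q)
        ⟨i, ⟨fun j hj => h1 j.castSucc hj, h2, fun j hj => h3 j.castSucc hj⟩, ha, hb⟩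
      rcases ih' with ⟨s, hs, ht⟩ | ⟨hs, ht⟩
      · rw [hs, ht]; exact ⟨(key a b hab).1 s, (key b a hab.symm).1 s⟩
      · rw [hs, ht]; exact ⟨(key a b hab).2, (key b a hab.symm).2⟩

/-- The code of the word `a a a`. -/
def corner (a : Fin 4) : ℕ := 21 * a

/-- The words of length three that the table `T` gives the color `k`. -/
def colorSet (T k : ℕ) : ℕ := (List.range 64).foldl
  (fun m u => if digit T u = k then m ||| 2 ^ u else m) 0

theorem testBit_colorSet {T k u : ℕ} (hu : u < 64) (h : digit T u = k) :
    (colorSet T k).testBit u := by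
  have key : ∀ (l : List ℕ) (m : ℕ), (m.testBit u ∨ u ∈ l) → (l.foldl
      (fun m u => if digit T u = k then m ||| 2 ^ u else m) m).testBit u := by
    intro l
    induction l with
    | nil => intro m h; simpa using h
    | cons v l ih =>
      intro m hm
      rw [List.foldl_cons]
      apply ih
      rcases hm with hm | hm
      · left; split_ifs <;> simp [hm]
      · rcases List.mem_cons.1 hm with rfl | hm
        · left; simp [h]
        · exact Or.inr hm
  exact key _ _ (Or.inr (List.mem_range.2 hu))

/-- No two words of the same color are close to each other through the edge from `b b b` to
`a a a` between blocks colored by `S` and `T`. -/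
def LinkCheck (a b : Fin 4) (S T : ℕ) : Bool :=
  (List.range 9).all fun k => force (colorSet S k) fun m => force (colorSet T k) fun n =>
    (List.range k).all fun e =>
      Nat.beq (Nat.land m (ball (edges 3) (corner b) e)) 0 ||
        Nat.beq (Nat.land n (ball (edges 3) (corner a) (k - 1 - e))) 0

theorem packingTable_table : ∀ s, PackingTable 3 8 (table s) = true := by decide +kernel

theorem linkCheck_pair : ∀ a b, pawGraph.Adj a b →
    LinkCheck a b (table (a, b)) (table (b, a)) = true := by decide +kernel
theorem linkCheck_step : ∀ a b, pawGraph.Adj a b → ∀ s,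
    LinkCheck a b (table (step s a)) (table (step s b)) = true := by decide +kernel

theorem code_const : ∀ a : Fin 4, code (fun _ : Fin 3 => a) = corner a := by decide

theorem corner_far : ∀ a b, a ≠ b → (ball (edges 3) (corner a) 6).testBit (corner b) = false := by
  decide +kernel

theorem edist_le_succ {V : Type*} {G : SimpleGraph V} {x y z : V} {d : ℕ} (h : G.edist x y ≤ d)
    (hyz : G.Adj y z) : G.edist x z ≤ (d + 1 : ℕ) := by
  refine (SimpleGraph.edist_triangle (v := y)).trans ?_
  rw [Nat.cast_add]
  exact add_le_add h (SimpleGraph.edist_eq_one_iff_adj.2 hyz).le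

/-- A vertex at distance at most `8` lies in the same block or in an adjacent one. -/
theorem block_of_edist_le {m : ℕ} {p : Fin m → Fin 4} {x : Fin 3 → Fin 4} {w : Fin (m + 3) → Fin 4}
    {d : ℕ} (hd : d ≤ 8)
    (h : (genSierpinskiGraph pawGraph (m + 3)).edist (Fin.append p x) w ≤ d) :
    (∃ y, w = Fin.append p y ∧ (genSierpinskiGraph pawGraph 3).edist x y ≤ d) ∨
      ∃ (q : Fin m → Fin 4) (y : Fin 3 → Fin 4) (a b : Fin 4) (e e' : ℕ), Linked a b p q ∧
        w = Fin.append q y ∧ e + 1 + e' ≤ d ∧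
        (genSierpinskiGraph pawGraph 3).edist x (fun _ => b) ≤ e ∧
        (genSierpinskiGraph pawGraph 3).edist (fun _ => a) y ≤ e' := by
  revert hd
  refine of_edist_le (fun d w => d ≤ 8 → (∃ y, w = Fin.append p y ∧
      (genSierpinskiGraph pawGraph 3).edist x y ≤ d) ∨
      ∃ (q : Fin m → Fin 4) (y : Fin 3 → Fin 4) (a b : Fin 4) (e e' : ℕ), Linked a b p q ∧
        w = Fin.append q y ∧ e + 1 + e' ≤ d ∧
        (genSierpinskiGraph pawGraph 3).edist x (fun _ => b) ≤ e ∧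
        (genSierpinskiGraph pawGraph 3).edist (fun _ => a) y ≤ e')
    (fun d _ => Or.inl ⟨x, rfl, by simp⟩) (fun d w w' ih hww hd => ?_) h
  obtain ⟨r, z, rfl⟩ : ∃ r z, w' = Fin.append r z :=
    ⟨_, _, (Fin.append_castAdd_natAdd (m := m) (n := 3)).symm⟩
  rcases ih (by omega) with ⟨y, rfl, hy⟩ | ⟨q, y, a, b, e, e', hpq, rfl, he, hx, hy⟩
  · rcases (genSierpinskiGraph_adj_append _ _ _ _).1 hww with ⟨rfl, hyz⟩ | ⟨i, hi, hyi, hzi⟩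
    · exact Or.inl ⟨z, rfl, edist_le_succ hy hyz⟩
    · obtain rfl : y = fun _ => r i := funext hyi
      obtain rfl : z = fun _ => p i := funext hzi
      -- The path has just entered the new block at its corner, so `e' = 0`.
      exact Or.inr ⟨r, _, p i, r i, d, 0, ⟨i, hi, rfl, rfl⟩, rfl, by omega, hy, by simp⟩
  · rcases (genSierpinskiGraph_adj_append _ _ _ _).1 hww with ⟨rfl, hyz⟩ | ⟨i, hi, hyi, hzi⟩
    · exact Or.inr ⟨q, z, a, b, e, e' + 1, hpq, rfl, by omega, hx, edist_le_succ hy hyz⟩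
    · obtain rfl : y = fun _ => r i := funext hyi
      obtain rfl : z = fun _ => q i := funext hzi
      -- Leaving `q` through the corner of entry returns to `p`. Leaving it elsewhere would require
      -- crossing `q` between two corners in `e' ≤ 6` steps.
      by_cases hra : r i = a
      · obtain ⟨rfl, hb⟩ := hpq.eq_of_linked ⟨i, hi, rfl, hra⟩
        rw [hb]
        exact Or.inl ⟨_, rfl, hx.trans (by exact_mod_cast (by omega : e ≤ d + 1))⟩
      · have hfar := testBit_ball_of_edist_le complete_three
          (hy.trans (by exact_mod_cast (by omega : e' ≤ 6)) : _ ≤ ((6 : ℕ) : ℕ∞))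
        rw [code_const, code_const, corner_far _ _ (Ne.symm hra)] at hfar
        exact absurd hfar (by simp)

theorem LinkCheck.spec {a b : Fin 4} {S T : ℕ} (h : LinkCheck a b S T = true) {x y : Fin 3 → Fin 4}
    {e e' : ℕ} (hS : digit S (code x) ≤ 8) (hST : digit S (code x) = digit T (code y))
    (he : e + 1 + e' ≤ digit S (code x))
    (hx : (genSierpinskiGraph pawGraph 3).edist x (fun _ => b) ≤ e)
    (hy : (genSierpinskiGraph pawGraph 3).edist (fun _ => a) y ≤ e') : False := by
  simp only [LinkCheck, force_eq, List.all_eq_true, List.mem_range, Bool.or_eq_true,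
    Nat.beq_eq] at h
  have meet : ∀ {m n u : ℕ}, m.testBit u → n.testBit u → Nat.land m n ≠ 0 := by
    intro m n u hm hn h0
    have := Nat.testBit_land m n u
    change (Nat.land m n).testBit u = _ at this
    rw [h0, hm, hn] at this
    simp at this
  rw [SimpleGraph.edist_comm] at hx
  have hx' := testBit_ball_of_edist_le complete_three hx
  -- Enlarging `e'` to `k - 1 - e` reduces the check to one value for each `e`.
  have hy' := testBit_ball_of_edist_le complete_three (hy.trans (by
    exact_mod_cast (by omega : e' ≤ digit S (code x) - 1 - e)))
  rw [code_const] at hx' hy'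
  rcases h (digit S (code x)) (by omega) e (by omega) with h | h
  · exact meet (testBit_colorSet (coded_three.1 x).1 rfl) hx' h
  · exact meet (testBit_colorSet (coded_three.1 y).1 hST.symm) hy' h

theorem le_eight (m : ℕ) :
    packingChromaticNumber (genSierpinskiGraph pawGraph (m + 3)) ≤ 8 := by
  have hfin : ∀ w : Fin (m + 3) → Fin 4, ∃ p x, w = Fin.append p x := fun w =>
    ⟨_, _, (Fin.append_castAdd_natAdd (m := m) (n := 3)).symm⟩
  obtain ⟨f, hf⟩ : ∃ f : (Fin (m + 3) → Fin 4) → ℕ,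
      ∀ p x, f (Fin.append p x) = digit (table (state m p)) (code x) :=
    ⟨fun w => digit (table (state m fun i => w (Fin.castAdd 3 i))) (code fun j => w (Fin.natAdd m j)),
      fun p x => by simp⟩
  have hcode : ∀ x : Fin 3 → Fin 4, code x < 4 ^ 3 := fun x => (coded_three.1 x).1
  have hspec := fun p => PackingTable.spec (packingTable_table (state m p))
  refine packingChromaticNumber_le (C := 8) (f := f) ⟨?_, fun u v huv hfuv => ?_⟩
  · ext k
    constructor
    · rintro ⟨w, rfl⟩
      obtain ⟨p, x, rfl⟩ := hfin w
      rw [hf]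
      exact (hspec p).2.1 _ (hcode x)
    · rintro ⟨hk, hk8⟩
      -- Every table uses all eight colors, so one block suffices for surjectivity.
      obtain ⟨u, hu, rfl⟩ := (hspec fun _ => 0).1 k hk hk8
      exact ⟨Fin.append (fun _ => 0) (word 3 u), by rw [hf, coded_three.2 u hu]⟩
  · by_contra hd
    obtain ⟨p, x, rfl⟩ := hfin u
    have h8 := ((hspec p).2.1 _ (hcode x)).2
    rw [not_lt, hf] at hd
    rw [hf] at hfuv
    rcases block_of_edist_le h8 hd with ⟨y, rfl, hy⟩ | ⟨q, y, a, b, e, e', hpq, rfl, he, hx, hy⟩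
    · rw [hf] at hfuv
      refine (hspec p).2.2 _ (hcode x) _ (hcode y) (fun h => huv ?_) hfuv
        (testBit_ball_of_edist_le complete_three hy)
      rw [← (coded_three.1 x).2, h, (coded_three.1 y).2]
    · rw [hf] at hfuv
      refine LinkCheck.spec ?_ h8 hfuv he hx hy
      rcases hpq.state with ⟨s, hp, hq⟩ | ⟨hp, hq⟩
      · rw [hp, hq]
        exact linkCheck_step a b hpq.adj s
      · rw [hp, hq]
        exact linkCheck_pair a b hpq.adj

end Sweep

theorem mainTheorem5 :
    packingChromaticNumber (genSierpinskiGraph pawGraph 1) = 3 ∧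
    packingChromaticNumber (genSierpinskiGraph pawGraph 2) = 5 ∧
    packingChromaticNumber (genSierpinskiGraph pawGraph 3) = 7 ∧
    ∀ n : ℕ, 4 ≤ n → packingChromaticNumber (genSierpinskiGraph pawGraph n) = 8 := by
  refine ⟨le_antisymm Sweep.le_three Sweep.three_le, le_antisymm Sweep.le_five Sweep.five_le,
    le_antisymm Sweep.le_seven Sweep.seven_le, fun n hn => ?_⟩
  obtain ⟨m, rfl⟩ : ∃ m, n = m + 1 + 3 := ⟨n - 4, by omega⟩
  exact le_antisymm (Sweep.le_eight (m + 1)) (Sweep.eight_le m)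

end
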